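/- A stratified group is realised as a homogeneous Carnot group: $\mathbb G=(\mathbb R^d,\circ,\delta_t)$, where $\circ$ is a Lie group law on $\mathbb R^d$ with identity $0$, the dilations $\delta_t(x)=(t^{w_1}x_1,\dots,t^{w_d}x_d)$, $t>0$, with integer weights $w_i\ge 1$, are automorphisms of $\circ$, and the left-invariant vector fields $X_i$ with $X_i(0)=\partial/\partial x_i$, $w_i=1$ (the first layer), generate together with their iterated commutators the tangent space at every point. Write $\nabla f=(X_if)_{w_i=1}$ for the sub-gradient, $|\nabla f|$ for its Euclidean length, and $\lambda$ for the Lebesgue measure on $\mathbb R^d$ (a Haar measure of $\mathbb G$). A smooth homogeneous norm on $\mathbb G$ is a continuous function $N:\mathbb G\to[0,\infty)$ that vanishes exactly at $0$, satisfies $N(\delta_t x)=tN(x)$ for all $t>0$, and is $C^\infty$ on $\mathbb G\setminus\{0\}$. For $0<\beta\le1$ and $q>1$, a measure $\mu$ on $\mathbb G$ satisfies the Log$^\beta$-Sobolev inequality with exponent $q$ if there are constants $C,D\in[0,\infty)$ such that $$\int|f|^q\left|\log\frac{|f|^q}{\int|f|^q\,d\mu}\right|^\beta d\mu\le C\int|\nabla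 f|^q\,d\mu+D\int|f|^q\,d\mu$$ for all locally Lipschitz functions $f$ for which $|f|^q$ and $|\nabla f|^q$ are $\mu$-integrable. Theorem 10. Let $\mathbb G$ be a non-commutative stratified group, let $N$ be a smooth homogeneous norm on $\mathbb G$, let $\alpha>0$ and $p\ge1$, and let $d\mu=\frac{e^{-\alpha N^p}}{Z}\,d\lambda$ with $Z=\int e^{-\alpha N^p}\,d\lambda$. Then, for every $0<\beta\le1$ and every $q$ with $1<q<\frac{2p\beta}{p-1}$ (every $q>1$ if $p=1$), the measure $\mu$ does not satisfy the Log$^\beta$-Sobolev inequality with exponent $q$. -/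

import Mathlib

open MeasureTheory
open scoped ContDiff

noncomputable section

/-- The dilation `δ_t x = (t ^ w₁ x₁, …, t ^ w_d x_d)` of `ℝ^d` with weights `w`. -/
def dilation {d : ℕ} (w : Fin d → ℕ) (t : ℝ) (x : Fin d → ℝ) : Fin d → ℝ :=
  fun i => t ^ w i * x i

/-- For a group law `mul` on `ℝ^d` with identity `0`: the left-invariant vector field that equals
`∂/∂x_i` at `0`, that is, the `i`-th column of the Jacobian matrix at `0` of the left
translation by `x`. -/
def leftField {d : ℕ} (mul : (Fin d → ℝ) → (Fin d → ℝ) → (Fin d → ℝ)) (i : Fin d) :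
    (Fin d → ℝ) → (Fin d → ℝ) :=
  fun x => fderiv ℝ (mul x) 0 (Pi.single i 1)

/-- The iterated commutators of the fields `X i`, for the indices `i` with `P i`
(the fields themselves included). -/
inductive IteratedCommutator {d : ℕ} (X : Fin d → (Fin d → ℝ) → (Fin d → ℝ)) (P : Fin d → Prop) :
    ((Fin d → ℝ) → (Fin d → ℝ)) → Prop
  | base (i : Fin d) (hi : P i) : IteratedCommutator X P (X i)
  | bracket (V W : (Fin d → ℝ) → (Fin d → ℝ)) (hV : IteratedCommutator X P V)
      (hW : IteratedCommutator X P W) : IteratedCommutator X P (VectorField.lieBracket ℝ V W)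

/-- A stratified (Carnot) group, realised on `ℝ^d` as a homogeneous Carnot group: a Lie group
structure on `ℝ^d` with identity `0`, such that the dilations with positive integer weights are
group automorphisms, and such that the left-invariant fields which extend `∂/∂x_i` for the
coordinates `i` of weight one (the first layer) generate, under commutators, the whole tangent
space at every point. -/
structure StratifiedGroup (d : ℕ) where
  weight : Fin d → ℕ
  weight_pos : ∀ i, 1 ≤ weight i
  mul : (Fin d → ℝ) → (Fin d → ℝ) → (Fin d → ℝ)
  inv : (Fin d → ℝ) → (Fin d → ℝ)
  mul_assoc : ∀ x y z, mul (mul x y) z = mul x (mul y z)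
  zero_mul : ∀ x, mul 0 x = x
  mul_zero : ∀ x, mul x 0 = x
  inv_mul : ∀ x, mul (inv x) x = 0
  contDiff_mul : ContDiff ℝ ∞ (fun z : (Fin d → ℝ) × (Fin d → ℝ) => mul z.1 z.2)
  contDiff_inv : ContDiff ℝ ∞ inv
  dilation_mul : ∀ t : ℝ, 0 < t → ∀ x y,
    dilation weight t (mul x y) = mul (dilation weight t x) (dilation weight t y)
  generates : ∀ x : Fin d → ℝ, Submodule.span ℝ
    {v | ∃ Y, IteratedCommutator (leftField mul) (fun i => weight i = 1) Y ∧ v = Y x} = ⊤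

namespace StratifiedGroup

variable {d : ℕ} (G : StratifiedGroup d)

/-- The group is not abelian (equivalently, its step is at least two). -/
def Noncommutative : Prop := ∃ x y, G.mul x y ≠ G.mul y x

/-- `N` is a smooth homogeneous norm: continuous, positive away from the identity and zero there,
homogeneous of degree one under the dilations, and `C^∞` away from the identity. -/
structure IsSmoothHomogeneousNorm (N : (Fin d → ℝ) → ℝ) : Prop where
  continuous : Continuous N
  nonneg : ∀ x, 0 ≤ N x
  eq_zero_iff : ∀ x, N x = 0 ↔ x = 0
  homogeneous : ∀ t : ℝ, 0 < t → ∀ x, N (dilation G.weight t x) = t * N x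
  smooth : ContDiffOn ℝ ∞ N {0}ᶜ

/-- The length `|∇f|(x)` of the sub-gradient `∇f = (X_i f)`, where `i` runs through the coordinates
of weight one. -/
def subgradNorm (f : (Fin d → ℝ) → ℝ) (x : Fin d → ℝ) : ℝ :=
  Real.sqrt (∑ i with G.weight i = 1, (fderiv ℝ f x (leftField G.mul i x)) ^ 2)

/-- The `Log^β`-Sobolev inequality with exponent `q`: there are constants `C, D ∈ [0, ∞)` with
`μ(|f|^q |log(|f|^q / μ|f|^q)|^β) ≤ C μ|∇f|^q + D μ|f|^q`
for all locally Lipschitz `f` for which the right-hand side is finite. -/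
def LogSobolev (μ : Measure (Fin d → ℝ)) (β q : ℝ) : Prop :=
  ∃ C D : ℝ, 0 ≤ C ∧ 0 ≤ D ∧ ∀ f : (Fin d → ℝ) → ℝ, LocallyLipschitz f →
    Integrable (fun x => |f x| ^ q) μ → Integrable (fun x => G.subgradNorm f x ^ q) μ →
    ∫⁻ x, ENNReal.ofReal (|f x| ^ q * |Real.log (|f x| ^ q / ∫ y, |f y| ^ q ∂μ)| ^ β) ∂μ ≤
      ENNReal.ofReal (C * ∫ x, G.subgradNorm f x ^ q ∂μ + D * ∫ x, |f x| ^ q ∂μ)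

end StratifiedGroup

/-- The measure `dμ = e^{-α N^p} dλ / Z`, with `λ` the Lebesgue measure on `ℝ^d` (a Haar measure of
the group) and `Z = ∫ e^{-α N^p} dλ`. -/
def gibbsMeasure {d : ℕ} (N : (Fin d → ℝ) → ℝ) (α p : ℝ) : Measure (Fin d → ℝ) :=
  (∫⁻ x, ENNReal.ofReal (Real.exp (-α * N x ^ p)))⁻¹ •
    volume.withDensity (fun x => ENNReal.ofReal (Real.exp (-α * N x ^ p)))

end

/-!
Some `x ≠ 0` is a critical point of `N` in the horizontal directions. Indeed, if the horizontal
gradient of `N` had no zero away from the origin, then it would be homotopic there to the Euler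
field through nowhere vanishing fields, because `dN` is positive on both. Read in the left-invariant
frame, the horizontal gradient avoids the directions above the first layer, so the homotopy would
extend over the origin, and the Euler field on a sphere would extend without zeros to the ball,
against the no-retraction theorem.

By Taylor expansion at such a point `x` and homogeneity, `N ^ p` oscillates by `O(1)` on the dilated
boxes of radius `t ^ (1 - p / 2)` around `δ_t x`, while it is of size `t ^ p` there. A cutoff
function at this scale has sub-gradient of size `t ^ (p / 2 - 1)`, and the logarithm of the mass of
its support is at most `-c * t ^ p`, so the inequality would give
`t ^ (p * β) ≲ t ^ (q * (p / 2 - 1)) + 1` as `t → ∞`, which fails for `q * (p - 2) < 2 * p * β`.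
-/

noncomputable section

/-! ### The no-retraction theorem -/

section NoRetraction

open Metric Set Polynomial

theorem exists_polynomial_eval_eq_integral {α : Type*} [MeasurableSpace α] {μ : Measure α}
    {P : α → ℝ[X]} {n : ℕ} (hdeg : ∀ x, (P x).natDegree ≤ n)
    (hint : ∀ t, Integrable (fun x => (P x).eval t) μ) :
    ∃ Q : ℝ[X], ∀ t, Q.eval t = ∫ x, (P x).eval t ∂μ := by
  set s := Finset.range (n + 1)
  have hnodes : InjOn (fun i : ℕ => (i : ℝ)) s := Nat.cast_injective.injOn
  have hlagrange : ∀ x t, (P x).eval t =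
      ∑ i ∈ s, (P x).eval (i : ℝ) * (Lagrange.basis s (fun i : ℕ => (i : ℝ)) i).eval t := by
    intro x t
    have hlt : (P x).degree < (s.card : WithBot ℕ) := by
      rw [Finset.card_range]
      exact degree_le_natDegree.trans_lt (by exact_mod_cast Nat.lt_succ_of_le (hdeg x))
    conv_lhs => rw [Lagrange.eq_interpolate hnodes hlt, Lagrange.interpolate_apply,
      eval_finsetSum]
    simp only [eval_mul, eval_C]
  refine ⟨∑ i ∈ s, C (∫ x, (P x).eval (i : ℝ) ∂μ) *
    Lagrange.basis s (fun i : ℕ => (i : ℝ)) i, fun t => ?_⟩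
  simp_rw [hlagrange _ t]
  rw [integral_finsetSum s fun i _ => (hint i).mul_const
    ((Lagrange.basis s (fun i : ℕ => (i : ℝ)) i).eval t)]
  simp only [eval_finsetSum, eval_mul, eval_C, integral_mul_const]

variable {E : Type*} [NormedAddCommGroup E]

theorem lipschitzWith_indicator_ball [NormedSpace ℝ E] {F : Type*} [NormedAddCommGroup F]
    {v : E → F} {L : NNReal} {R : ℝ} (hv : LipschitzOnWith L v (closedBall 0 R))
    (hzero : ∀ x, ‖x‖ = R → v x = 0) : LipschitzWith L ((ball (0 : E) R).indicator v) := by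
  have dist_le_of_crossing : ∀ x ∈ ball (0 : E) R, ∀ y ∉ ball (0 : E) R,
      dist (v x) 0 ≤ L * dist x y := by
    intro x hx y hy
    have hcont : ContinuousOn (fun s : ℝ => ‖AffineMap.lineMap x y s‖) (Icc 0 1) :=
      AffineMap.lineMap_continuous.norm.continuousOn
    have hR : R ∈ Icc ‖AffineMap.lineMap x y (0 : ℝ)‖ ‖AffineMap.lineMap x y (1 : ℝ)‖ := by
      rw [AffineMap.lineMap_apply_zero, AffineMap.lineMap_apply_one]
      exact ⟨(mem_ball_zero_iff.1 hx).le, by simpa using hy⟩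
    obtain ⟨s, hs, hsR⟩ := intermediate_value_Icc zero_le_one hcont hR
    calc dist (v x) 0 = dist (v x) (v (AffineMap.lineMap x y s)) := by rw [hzero _ hsR]
      _ ≤ L * dist x (AffineMap.lineMap x y s) :=
        hv.dist_le_mul x (ball_subset_closedBall hx) _ (by simpa using hsR.le)
      _ ≤ L * dist x y := by
        rw [dist_left_lineMap, Real.norm_of_nonneg hs.1]
        gcongr
        exact mul_le_of_le_one_left dist_nonneg hs.2
  refine LipschitzWith.of_dist_le_mul fun x y => ?_
  by_cases hx : x ∈ ball (0 : E) R <;> by_cases hy : y ∈ ball (0 : E) R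
  · rw [indicator_of_mem hx, indicator_of_mem hy]
    exact hv.dist_le_mul x (ball_subset_closedBall hx) y (ball_subset_closedBall hy)
  · rw [indicator_of_mem hx, indicator_of_notMem hy]
    exact dist_le_of_crossing x hx y hy
  · rw [indicator_of_notMem hx, indicator_of_mem hy, dist_comm, dist_comm x]
    exact dist_le_of_crossing y hy x hx
  · rw [indicator_of_notMem hx, indicator_of_notMem hy, dist_self]
    positivity

theorem exists_polynomial_eval_eq_det_one_add_smul [NormedSpace ℝ E] [FiniteDimensional ℝ E]
    (A : E →L[ℝ] E) :
    ∃ P : ℝ[X], P.natDegree ≤ Module.finrank ℝ E ∧ ∀ t : ℝ, P.eval t = (1 + t • A).det := by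
  let b := Module.finBasis ℝ E
  let M := LinearMap.toMatrix b b (A : E →ₗ[ℝ] E)
  refine ⟨((X : ℝ[X]) • M.map C + (1 : Matrix _ _ ℝ).map C).det, ?_, fun t => ?_⟩
  · simpa using natDegree_det_X_add_C_le M 1
  · have hdet : (1 + t • A).det = (1 + t • M).det := by
      rw [ContinuousLinearMap.det, ← LinearMap.det_toMatrix b]
      congr 1
      simp [M, LinearMap.toMatrix_one]
    rw [hdet, ← coe_evalRingHom, RingHom.map_det]
    congr 1
    ext i j
    by_cases hij : i = j <;> simp [hij, mul_comm t, add_comm]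

theorem det_one_add_pos [NormedSpace ℝ E] [FiniteDimensional ℝ E] {A : E →L[ℝ] E}
    (hA : ‖A‖ < 1) : 0 < (1 + A).det := by
  have hcont : ContinuousOn (fun t : ℝ => (1 + t • A).det) (Icc 0 1) :=
    (ContinuousLinearMap.continuous_det.comp (by fun_prop)).continuousOn
  have hne : ∀ t ∈ Icc (0 : ℝ) 1, (1 + t • A).det ≠ 0 := by
    intro t ht
    have hsmall : ‖-(t • A)‖ < 1 := by
      rw [norm_neg, norm_smul, Real.norm_of_nonneg ht.1]
      exact (mul_le_of_le_one_left (norm_nonneg A) ht.2).trans_lt hA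
    have hunit := (isUnit_one_sub_of_norm_lt_one hsmall).map
      (ContinuousLinearMap.toLinearMapRingHom (R₁ := ℝ) (M₁ := E))
    rw [sub_neg_eq_add] at hunit
    exact (LinearMap.isUnit_det _ hunit).ne_zero
  by_contra! hle
  have hzero : (0 : ℝ) ∈ Icc (1 + (1 : ℝ) • A).det (1 + (0 : ℝ) • A).det := by
    rw [one_smul, zero_smul, add_zero]
    exact ⟨hle, by simp [ContinuousLinearMap.det]⟩
  obtain ⟨t, ht, h0⟩ := intermediate_value_Icc' zero_le_one hcont hzero
  exact hne t ht h0

theorem bijective_id_add [NormedSpace ℝ E] [CompleteSpace E] {u : E → E} {L : NNReal}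
    (hL : L < 1) (hu : LipschitzWith L u) : Function.Bijective fun x => x + u x := by
  have happrox : ApproximatesLinearOn (fun x => x + u x)
      (ContinuousLinearEquiv.refl ℝ E : E →L[ℝ] E) univ L := by
    intro x _ y _
    simpa [add_sub_add_comm, dist_eq_norm] using hu.dist_le_mul x y
  have hsmall : Subsingleton E ∨
      L < ‖((ContinuousLinearEquiv.refl ℝ E).symm : E →L[ℝ] E)‖₊⁻¹ := by
    rcases subsingleton_or_nontrivial E with h | h
    · exact Or.inl h
    · right
      have hid : ((ContinuousLinearEquiv.refl ℝ E).symm : E →L[ℝ] E) =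
        ContinuousLinearMap.id ℝ E := rfl
      rwa [hid, ContinuousLinearMap.nnnorm_id, inv_one]
  exact ⟨fun x y h => happrox.injOn hsmall (mem_univ x) (mem_univ y) h,
    happrox.surjective hsmall⟩

theorem image_ball_id_add {u : E → E} (hbij : Function.Bijective fun x => x + u x) {R : ℝ}
    (hR : ∀ x, R ≤ ‖x‖ → u x = 0) : (fun x => x + u x) '' ball 0 R = ball 0 R := by
  have hfix : ∀ x, R ≤ ‖x‖ → x + u x = x := fun x hx => by rw [hR x hx, add_zero]
  refine Subset.antisymm ?_ ?_
  · rintro _ ⟨x, hx, rfl⟩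
    by_contra hy
    have hxy : x + u x = x := hbij.injective (hfix _ (by simpa using hy))
    exact hy (by simpa only [hxy] using hx)
  · intro y hy
    obtain ⟨x, rfl⟩ := hbij.surjective y
    refine ⟨x, ?_, rfl⟩
    by_contra hx
    exact hx (by simpa only [hfix x (by simpa using hx)] using hy)

section Volume

variable [NormedSpace ℝ E] [FiniteDimensional ℝ E] [MeasurableSpace E] [BorelSpace E]
  (μ : Measure E) [μ.IsAddHaarMeasure]

theorem setIntegral_det_one_add_fderiv_of_lt_one {u : E → E} {L : NNReal} (hL : L < 1)
    (hu : LipschitzWith L u) {R : ℝ} (hR : ∀ x, R ≤ ‖x‖ → u x = 0)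
    (hd : ∀ x ∈ ball (0 : E) R, DifferentiableAt ℝ u x) :
    ∫ x in ball (0 : E) R, (1 + fderiv ℝ u x).det ∂μ = μ.real (ball 0 R) := by
  have hbij := bijective_id_add hL hu
  have hderiv : ∀ x ∈ ball (0 : E) R,
      HasFDerivWithinAt (fun x => x + u x) (1 + fderiv ℝ u x) (ball 0 R) x :=
    fun x hx => ((hasFDerivAt_id x).add (hd x hx).hasFDerivAt).hasFDerivWithinAt
  have hvol := lintegral_abs_det_fderiv_eq_addHaar_image μ measurableSet_ball hderiv
    hbij.injective.injOn
  have hpos : ∀ x, 0 < (1 + fderiv ℝ u x).det := fun x =>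
    det_one_add_pos ((norm_fderiv_le_of_lipschitz ℝ hu).trans_lt (by exact_mod_cast hL))
  have hmeas : Measurable fun x => (1 + fderiv ℝ u x).det :=
    ContinuousLinearMap.continuous_det.measurable.comp ((measurable_fderiv ℝ u).const_add 1)
  rw [image_ball_id_add hbij hR] at hvol
  rw [integral_eq_lintegral_of_nonneg_ae (.of_forall fun x => (hpos x).le)
    hmeas.aestronglyMeasurable, Measure.real, ← hvol]
  simp_rw [abs_of_pos (hpos _)]

theorem integrableOn_ball_det_one_add_smul_fderiv {u : E → E} {L : NNReal}
    (hu : LipschitzWith L u) (t R : ℝ) :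
    IntegrableOn (fun x => (1 + t • fderiv ℝ u x).det) (ball 0 R) μ := by
  have hcont : Continuous fun A : E →L[ℝ] E => (1 + t • A).det :=
    ContinuousLinearMap.continuous_det.comp (by fun_prop)
  obtain ⟨K, hK⟩ := (isCompact_closedBall (0 : E →L[ℝ] E) L).exists_bound_of_continuousOn
    hcont.continuousOn
  refine Measure.integrableOn_of_bounded (M := K) measure_ball_lt_top.ne
    (hcont.measurable.comp (measurable_fderiv ℝ u)).aestronglyMeasurable
    (.of_forall fun x => hK _ ?_)
  simpa using norm_fderiv_le_of_lipschitz ℝ hu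

-- In `t`, the signed volume of `x ↦ x + t u(x)` is a polynomial, and it is constant for small `t`.
theorem setIntegral_det_one_add_fderiv {u : E → E} {L : NNReal} (hu : LipschitzWith L u) {R : ℝ}
    (hR : ∀ x, R ≤ ‖x‖ → u x = 0) (hd : ∀ x ∈ ball (0 : E) R, DifferentiableAt ℝ u x) :
    ∫ x in ball (0 : E) R, (1 + fderiv ℝ u x).det ∂μ = μ.real (ball 0 R) := by
  choose P hdeg hP using exists_polynomial_eval_eq_det_one_add_smul (E := E)
  obtain ⟨Q, hQ⟩ : ∃ Q : ℝ[X], ∀ t, Q.eval t =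
      ∫ x in ball (0 : E) R, (1 + t • fderiv ℝ u x).det ∂μ := by
    simp_rw [← hP]
    refine exists_polynomial_eval_eq_integral (fun x => hdeg _) fun t => ?_
    simp_rw [hP]
    exact integrableOn_ball_det_one_add_smul_fderiv μ hu t R
  have hsmall : ∀ t ∈ Ioo (0 : ℝ) (L + 1)⁻¹, Q.eval t = (C (μ.real (ball 0 R))).eval t := by
    rintro t ⟨ht0, ht1⟩
    lift t to NNReal using ht0.le
    have hlt : t * L < 1 := by
      have := (lt_inv_comm₀ ht0 (by positivity)).1 ht1
      rw [← NNReal.coe_lt_coe, NNReal.coe_mul, NNReal.coe_one, ← lt_inv_mul_iff₀ ht0, mul_one]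
      linarith
    have hlip : LipschitzWith (t * L) (fun x => (t : ℝ) • u x) := by
      simpa [Function.comp_def] using (lipschitzWith_smul (t : ℝ)).comp hu
    have hvol := setIntegral_det_one_add_fderiv_of_lt_one μ hlt hlip
      (fun x hx => by rw [hR x hx, smul_zero]) fun x hx => (hd x hx).const_smul (t : ℝ)
    rw [hQ, eval_C, ← hvol]
    exact setIntegral_congr_fun measurableSet_ball fun x hx => by
      simp only [fderiv_fun_const_smul (hd x hx)]
  have hconst : Q = C (μ.real (ball 0 R)) :=
    eq_of_infinite_eval_eq _ _ ((Ioo_infinite (by positivity)).mono hsmall)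
  simpa [hconst] using (hQ 1).symm

end Volume

theorem det_fderiv_eq_zero_of_norm_eq_one [InnerProductSpace ℝ E] [FiniteDimensional ℝ E]
    {k : E → E} {x : E} (hk : DifferentiableAt ℝ k x) (hnorm : ∀ y, ‖k y‖ = 1) :
    (fderiv ℝ k x).det = 0 := by
  by_contra hdet
  have hunit : IsUnit (fderiv ℝ k x : E →ₗ[ℝ] E) :=
    (LinearMap.isUnit_iff_isUnit_det _).2 (isUnit_iff_ne_zero.2 hdet)
  obtain ⟨v, hv⟩ := ((Module.End.isUnit_iff _).1 hunit).2 (k x)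
  have hconst : HasFDerivAt (fun y => inner ℝ (k y) (k y)) (0 : E →L[ℝ] ℝ) x := by
    simp_rw [real_inner_self_eq_norm_sq, hnorm]
    exact hasFDerivAt_const _ _
  have hortho := DFunLike.congr_fun
    ((hk.hasFDerivAt.inner ℝ hk.hasFDerivAt).unique hconst) v
  have hv' : fderiv ℝ k x v = k x := hv
  simp [fderivInnerCLM_apply, hv', hnorm] at hortho

theorem exists_smul_ne_self_of_norm_eq_one [InnerProductSpace ℝ E] [FiniteDimensional ℝ E]
    {k : E → E} (hk : ContDiff ℝ 1 k) (hnorm : ∀ x, ‖k x‖ = 1) {R : ℝ} (hR : 0 < R) :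
    ∃ x, ‖x‖ = R ∧ R • k x ≠ x := by
  by_contra! hfix
  borelize E
  set v : E → E := fun x => R • k x - x
  have hv : ContDiff ℝ 1 v := (hk.const_smul R).sub contDiff_id
  have hvR : ∀ x, ‖x‖ = R → v x = 0 := fun x hx => sub_eq_zero.2 (hfix x hx)
  obtain ⟨L, hL⟩ := hv.contDiffOn.exists_lipschitzOnWith one_ne_zero
    (convex_closedBall (0 : E) R) (isCompact_closedBall 0 R)
  set u := (ball (0 : E) R).indicator v
  have huv : ∀ x ∈ ball (0 : E) R, u =ᶠ[nhds x] v := fun x hx =>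
    Filter.eventually_of_mem (isOpen_ball.mem_nhds hx) fun y hy => indicator_of_mem hy v
  have hvol := setIntegral_det_one_add_fderiv (Measure.addHaar : Measure E)
    (lipschitzWith_indicator_ball hL hvR)
    (fun x hx => indicator_of_notMem (by simpa using hx) v)
    fun x hx => (hv.differentiable one_ne_zero x).congr_of_eventuallyEq (huv x hx)
  have hdet : ∀ x ∈ ball (0 : E) R, (1 + fderiv ℝ u x).det = 0 := by
    intro x hx
    have hkx : DifferentiableAt ℝ k x := hk.differentiable one_ne_zero x
    have hderiv : HasFDerivAt v (R • fderiv ℝ k x - 1) x :=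
      (hkx.hasFDerivAt.const_smul R).sub (hasFDerivAt_id x)
    have hdetk : LinearMap.det (fderiv ℝ k x : E →ₗ[ℝ] E) = 0 :=
      det_fderiv_eq_zero_of_norm_eq_one hkx hnorm
    rw [(huv x hx).fderiv_eq, hderiv.fderiv, add_sub_cancel, ContinuousLinearMap.det,
      ContinuousLinearMap.toLinearMap_smul, LinearMap.det_smul, hdetk, mul_zero]
  rw [setIntegral_congr_fun measurableSet_ball hdet, integral_zero] at hvol
  have hball : 0 < (Measure.addHaar : Measure E).real (ball 0 R) :=
    ENNReal.toReal_pos (measure_ball_pos _ _ hR).ne' measure_ball_lt_top.ne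
  exact hball.ne hvol

theorem exists_eq_zero_of_eq_id_off_ball_of_inner [InnerProductSpace ℝ E] [FiniteDimensional ℝ E]
    {g : E → E} (hg : ContDiff ℝ 1 g) {r : ℝ} (hr : ∀ x, r ≤ ‖x‖ → g x = x) : ∃ x, g x = 0 := by
  by_contra! hne
  have hR : 0 < max r 1 := one_pos.trans_le (le_max_right _ _)
  obtain ⟨x, hx, hne'⟩ := exists_smul_ne_self_of_norm_eq_one
    (k := fun x => ‖g x‖⁻¹ • g x)
    (((hg.norm ℝ hne).inv fun x => norm_ne_zero_iff.2 (hne x)).smul hg)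
    (fun x => norm_smul_inv_norm (𝕜 := ℝ) (hne x)) hR
  refine hne' ?_
  rw [hr x (hx ▸ le_max_left _ _), hx, smul_inv_smul₀ hR.ne']

theorem exists_eq_zero_of_eq_id_off_ball [NormedSpace ℝ E] [FiniteDimensional ℝ E] {g : E → E}
    (hg : ContDiff ℝ 1 g) {r : ℝ} (hr : ∀ x, r ≤ ‖x‖ → g x = x) : ∃ x, g x = 0 := by
  let e : E ≃L[ℝ] EuclideanSpace ℝ (Fin (Module.finrank ℝ E)) := toEuclidean
  obtain ⟨K, hK⟩ := (isCompact_closedBall (0 : E) r).exists_bound_of_continuousOn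
    e.continuous.continuousOn
  obtain ⟨z, hz⟩ := exists_eq_zero_of_eq_id_off_ball_of_inner
    (g := fun z => e (g (e.symm z))) (r := K + 1)
    (e.contDiff.comp (hg.comp e.symm.contDiff)) fun z hz => by
      have hfar : r ≤ ‖e.symm z‖ := by
        by_contra! hlt
        have := hK (e.symm z) (by simpa using hlt.le)
        rw [e.apply_symm_apply] at this
        linarith
      rw [hr _ hfar, e.apply_symm_apply]
  exact ⟨e.symm z, by simpa using hz⟩

end NoRetraction

/-! ### Dilations -/

section Dilation

variable {d : ℕ} {w : Fin d → ℕ}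

/-- The dilation `δ_t` as a continuous linear map. -/
def dilationCLM (w : Fin d → ℕ) (t : ℝ) : (Fin d → ℝ) →L[ℝ] (Fin d → ℝ) :=
  ContinuousLinearMap.pi fun i => (t ^ w i • 1 : ℝ →L[ℝ] ℝ).comp (ContinuousLinearMap.proj i)

/-- The homogeneous dimension `w₁ + … + w_d`: the exponent with which `δ_t` scales volume. -/
def homogeneousDim (w : Fin d → ℕ) : ℕ := ∑ i, w i

theorem dilationCLM_apply (w : Fin d → ℕ) (t : ℝ) (x : Fin d → ℝ) :
    dilationCLM w t x = dilation w t x := rfl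

theorem dilation_dilation (w : Fin d → ℕ) (s t : ℝ) (x : Fin d → ℝ) :
    dilation w s (dilation w t x) = dilation w (s * t) x := by
  funext i
  simp only [dilation, mul_pow, mul_assoc]

theorem dilation_one (w : Fin d → ℕ) (x : Fin d → ℝ) : dilation w 1 x = x := by
  funext i
  simp only [dilation, one_pow, one_mul]

theorem dilation_inv_dilation (w : Fin d → ℕ) {t : ℝ} (ht : t ≠ 0) (x : Fin d → ℝ) :
    dilation w t⁻¹ (dilation w t x) = x := by
  rw [dilation_dilation, inv_mul_cancel₀ ht, dilation_one]

theorem dilation_dilation_inv (w : Fin d → ℕ) {t : ℝ} (ht : t ≠ 0) (x : Fin d → ℝ) :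
    dilation w t (dilation w t⁻¹ x) = x := by
  rw [dilation_dilation, mul_inv_cancel₀ ht, dilation_one]

theorem dilation_single (w : Fin d → ℕ) (t : ℝ) (i : Fin d) (c : ℝ) :
    dilation w t (Pi.single i c) = t ^ w i • Pi.single i c := by
  funext j
  rcases eq_or_ne j i with rfl | h
  · simp [dilation]
  · simp [dilation, h]

theorem dilation_zero_left (hw : ∀ i, 1 ≤ w i) (x : Fin d → ℝ) : dilation w 0 x = 0 := by
  funext i
  simp [dilation, (Nat.one_le_iff_ne_zero.1 (hw i))]

theorem continuous_dilation_left (w : Fin d → ℕ) (x : Fin d → ℝ) :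
    Continuous fun t => dilation w t x :=
  continuous_pi fun i => (continuous_id.pow (w i)).mul_const (x i)

theorem norm_dilation_le_mul (hw : ∀ i, 1 ≤ w i) {t : ℝ} (ht : t ∈ Set.Icc 0 1)
    (x : Fin d → ℝ) : ‖dilation w t x‖ ≤ t * ‖x‖ := by
  have ht0 : 0 ≤ t := ht.1
  refine (pi_norm_le_iff_of_nonneg (by positivity)).2 fun i => ?_
  rw [dilation, norm_mul, norm_pow, Real.norm_of_nonneg ht0]
  gcongr
  · exact pow_le_of_le_one ht0 ht.2 (Nat.one_le_iff_ne_zero.1 (hw i))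
  · exact norm_le_pi_norm x i

theorem norm_dilation_le_pow_mul {t : ℝ} (ht : 1 ≤ t) (x : Fin d → ℝ) :
    ‖dilation w t x‖ ≤ t ^ homogeneousDim w * ‖x‖ := by
  refine (pi_norm_le_iff_of_nonneg (by positivity)).2 fun i => ?_
  rw [dilation, norm_mul, norm_pow, Real.norm_of_nonneg (by positivity)]
  gcongr
  · exact Finset.single_le_sum (f := w) (fun _ _ => Nat.zero_le _) (Finset.mem_univ i)
  · exact norm_le_pi_norm x i

theorem det_dilationCLM (w : Fin d → ℕ) (t : ℝ) :
    (dilationCLM w t).det = t ^ homogeneousDim w := by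
  rw [dilationCLM, ContinuousLinearMap.det_pi, homogeneousDim, ← Finset.prod_pow_eq_pow_sum]
  refine Finset.prod_congr rfl fun i _ => ?_
  simp [ContinuousLinearMap.det]

theorem volume_preimage_dilation (w : Fin d → ℕ) {t : ℝ} (ht : 0 < t) (s : Set (Fin d → ℝ)) :
    volume (dilation w t ⁻¹' s) = ENNReal.ofReal (t⁻¹ ^ homogeneousDim w) * volume s := by
  have hdet : LinearMap.det (dilationCLM w t : (Fin d → ℝ) →ₗ[ℝ] (Fin d → ℝ)) =
      t ^ homogeneousDim w := det_dilationCLM w t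
  have hvol := Measure.addHaar_preimage_continuousLinearMap volume (f := dilationCLM w t)
    (by rw [hdet]; positivity) s
  rwa [hdet, ← inv_pow, abs_of_pos (by positivity)] at hvol

end Dilation

/-! ### The left-invariant frame and the Lebesgue measure -/

namespace StratifiedGroup

variable {d : ℕ} (G : StratifiedGroup d)

theorem mul_inv (x : Fin d → ℝ) : G.mul x (G.inv x) = 0 := by
  have h : G.mul (G.inv (G.inv x)) (G.mul (G.inv x) (G.mul x (G.inv x))) = G.mul x (G.inv x) := by
    rw [← G.mul_assoc, G.inv_mul, G.zero_mul]
  rw [← h, ← G.mul_assoc (G.inv x), G.inv_mul, G.zero_mul, G.inv_mul]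

theorem inv_mul_cancel_left (y x : Fin d → ℝ) : G.mul (G.inv y) (G.mul y x) = x := by
  rw [← G.mul_assoc, G.inv_mul, G.zero_mul]

theorem mul_inv_cancel_left (y x : Fin d → ℝ) : G.mul y (G.mul (G.inv y) x) = x := by
  rw [← G.mul_assoc, G.mul_inv, G.zero_mul]

theorem contDiff_mul_left (x : Fin d → ℝ) : ContDiff ℝ ∞ (G.mul x) :=
  G.contDiff_mul.comp (contDiff_const.prodMk contDiff_id)

theorem differentiable_mul_left (x : Fin d → ℝ) : Differentiable ℝ (G.mul x) :=
  (G.contDiff_mul_left x).differentiable (by simp)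

/-- The differential at the identity of the left translation by `x`, so that the left-invariant
field `X_i` is `x ↦ G.frame x e_i`. -/
def frame (x : Fin d → ℝ) : (Fin d → ℝ) →L[ℝ] (Fin d → ℝ) := fderiv ℝ (G.mul x) 0

theorem leftField_eq_frame (i : Fin d) (x : Fin d → ℝ) :
    leftField G.mul i x = G.frame x (Pi.single i 1) := rfl

theorem contDiff_frame : ContDiff ℝ ∞ G.frame :=
  ContDiff.fderiv (f := G.mul) (g := fun _ => 0) G.contDiff_mul contDiff_const (by simp)

theorem frame_zero : G.frame 0 = ContinuousLinearMap.id ℝ _ := by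
  have hmul : G.mul 0 = id := funext G.zero_mul
  rw [frame, hmul, fderiv_id]

theorem fderiv_mul_comp_frame (y x : Fin d → ℝ) :
    (fderiv ℝ (G.mul y) x).comp (G.frame x) = G.frame (G.mul y x) := by
  have hmul : G.mul (G.mul y x) = G.mul y ∘ G.mul x := funext fun z => G.mul_assoc y x z
  have hy : DifferentiableAt ℝ (G.mul y) (G.mul x 0) := G.differentiable_mul_left y _
  rw [frame, frame, hmul, fderiv_comp _ hy (G.differentiable_mul_left x 0), G.mul_zero]

theorem frame_dilation_comp {t : ℝ} (ht : 0 < t) (x : Fin d → ℝ) :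
    (G.frame (dilation G.weight t x)).comp (dilationCLM G.weight t) =
      (dilationCLM G.weight t).comp (G.frame x) := by
  have hmul : G.mul (dilation G.weight t x) ∘ dilationCLM G.weight t =
      dilationCLM G.weight t ∘ G.mul x :=
    funext fun z => (G.dilation_mul t ht x z).symm
  have hderiv := congrArg (fun f => fderiv ℝ f 0) hmul
  rwa [fderiv_comp _ (G.differentiable_mul_left _ _) (dilationCLM G.weight t).differentiableAt,
    fderiv_comp _ (dilationCLM G.weight t).differentiableAt (G.differentiable_mul_left x 0),
    ContinuousLinearMap.fderiv, ContinuousLinearMap.fderiv, map_zero] at hderiv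

theorem frame_injective (x : Fin d → ℝ) : Function.Injective (G.frame x) := by
  have hinv := G.fderiv_mul_comp_frame (G.inv x) x
  rw [G.inv_mul, G.frame_zero] at hinv
  exact Function.LeftInverse.injective (g := fderiv ℝ (G.mul (G.inv x)) x) (DFunLike.congr_fun hinv)

theorem det_frame_dilation {t : ℝ} (ht : 0 < t) (x : Fin d → ℝ) :
    (G.frame (dilation G.weight t x)).det = (G.frame x).det := by
  have hdet : (G.frame (dilation G.weight t x)).det * (dilationCLM G.weight t).det =
      (dilationCLM G.weight t).det * (G.frame x).det :=
    (LinearMap.det_comp _ _).symm.trans <|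
      (congrArg ContinuousLinearMap.det (G.frame_dilation_comp ht x)).trans (LinearMap.det_comp _ _)
  rw [mul_comm] at hdet
  exact mul_left_cancel₀ (by rw [det_dilationCLM]; positivity) hdet

-- Dilating `x` to the identity does not change the determinant, which is `1` there.
theorem det_frame (x : Fin d → ℝ) : (G.frame x).det = 1 := by
  have hcont : Continuous fun t : ℝ => (G.frame (dilation G.weight t x)).det :=
    ContinuousLinearMap.continuous_det.comp
      (G.contDiff_frame.continuous.comp (continuous_dilation_left G.weight x))
  have hlim := (hcont.tendsto 0).mono_left (nhdsWithin_le_nhds (s := Set.Ioi 0))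
  rw [dilation_zero_left G.weight_pos, G.frame_zero] at hlim
  have hconst : (fun _ : ℝ => (G.frame x).det) =ᶠ[nhdsWithin 0 (Set.Ioi 0)]
      fun t => (G.frame (dilation G.weight t x)).det := by
    filter_upwards [self_mem_nhdsWithin] with t ht using (G.det_frame_dilation ht x).symm
  rw [tendsto_nhds_unique (tendsto_const_nhds.congr' hconst) hlim]
  simp [ContinuousLinearMap.det]

theorem det_fderiv_mul (y x : Fin d → ℝ) : (fderiv ℝ (G.mul y) x).det = 1 := by
  have hdet : (fderiv ℝ (G.mul y) x).det * (G.frame x).det = (G.frame (G.mul y x)).det :=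
    (LinearMap.det_comp _ _).symm.trans
      (congrArg ContinuousLinearMap.det (G.fderiv_mul_comp_frame y x))
  rwa [G.det_frame, G.det_frame, mul_one] at hdet

theorem volume_preimage_mul (y : Fin d → ℝ) {s : Set (Fin d → ℝ)} (hs : MeasurableSet s) :
    volume (G.mul y ⁻¹' s) = volume s := by
  have himage : G.mul y '' (G.mul y ⁻¹' s) = s :=
    Set.image_preimage_eq s (Function.RightInverse.surjective (G.mul_inv_cancel_left y))
  have hvol := lintegral_abs_det_fderiv_eq_addHaar_image volume
    ((G.differentiable_mul_left y).continuous.measurable hs)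
    (fun x _ => (G.differentiable_mul_left y x).hasFDerivAt.hasFDerivWithinAt)
    (Function.LeftInverse.injective (G.inv_mul_cancel_left y)).injOn
  rw [himage] at hvol
  simpa [G.det_fderiv_mul] using hvol

/-- The chart `x ↦ δ_{1/r}(y⁻¹ x)`, inverse to `k ↦ y δ_r(k)`, which magnifies the surroundings of
`y` at scale `r` to unit size. -/
def rescale (y : Fin d → ℝ) (r : ℝ) (x : Fin d → ℝ) : Fin d → ℝ :=
  dilation G.weight r⁻¹ (G.mul (G.inv y) x)

/-- The box `y δ_r(k)`, `‖k‖ ≤ R`, encoded as a preimage under the inverse chart. -/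
def box (y : Fin d → ℝ) (r R : ℝ) : Set (Fin d → ℝ) :=
  G.rescale y r ⁻¹' Metric.closedBall 0 R

theorem contDiff_rescale (y : Fin d → ℝ) (r : ℝ) : ContDiff ℝ ∞ (G.rescale y r) :=
  (dilationCLM G.weight r⁻¹).contDiff.comp (G.contDiff_mul_left _)

theorem mul_dilation_rescale (y : Fin d → ℝ) {r : ℝ} (hr : r ≠ 0) (x : Fin d → ℝ) :
    G.mul y (dilation G.weight r (G.rescale y r x)) = x := by
  rw [rescale, dilation_dilation_inv _ hr, G.mul_inv_cancel_left]

theorem exists_eq_mul_dilation_of_mem_box {y x : Fin d → ℝ} {r R : ℝ} (hr : r ≠ 0)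
    (hx : x ∈ G.box y r R) : ∃ k, ‖k‖ ≤ R ∧ x = G.mul y (dilation G.weight r k) :=
  ⟨G.rescale y r x, mem_closedBall_zero_iff.1 hx, (G.mul_dilation_rescale y hr x).symm⟩

theorem box_subset_box (y : Fin d → ℝ) (r : ℝ) {R₁ R₂ : ℝ} (h : R₁ ≤ R₂) :
    G.box y r R₁ ⊆ G.box y r R₂ :=
  Set.preimage_mono (Metric.closedBall_subset_closedBall h)

theorem measurableSet_box (y : Fin d → ℝ) (r R : ℝ) : MeasurableSet (G.box y r R) :=
  (G.contDiff_rescale y r).continuous.measurable Metric.isClosed_closedBall.measurableSet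

theorem volume_box (y : Fin d → ℝ) {r R : ℝ} (hr : 0 < r) (hR : 0 ≤ R) :
    volume (G.box y r R) = ENNReal.ofReal (r ^ homogeneousDim G.weight * (2 * R) ^ d) := by
  have hball : MeasurableSet (dilation G.weight r⁻¹ ⁻¹' Metric.closedBall 0 R) :=
    (dilationCLM G.weight r⁻¹).continuous.measurable Metric.isClosed_closedBall.measurableSet
  calc volume (G.box y r R)
      = volume (dilation G.weight r⁻¹ ⁻¹' Metric.closedBall 0 R) :=
        G.volume_preimage_mul (G.inv y) hball
    _ = ENNReal.ofReal (r ^ homogeneousDim G.weight) * ENNReal.ofReal ((2 * R) ^ d) := by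
        rw [volume_preimage_dilation _ (inv_pos.2 hr), inv_inv, Real.volume_pi_closedBall 0 hR,
          Fintype.card_fin]
    _ = ENNReal.ofReal (r ^ homogeneousDim G.weight * (2 * R) ^ d) :=
        (ENNReal.ofReal_mul (by positivity)).symm

theorem volumeReal_box (y : Fin d → ℝ) {r R : ℝ} (hr : 0 < r) (hR : 0 ≤ R) :
    volume.real (G.box y r R) = r ^ homogeneousDim G.weight * (2 * R) ^ d := by
  rw [Measure.real, G.volume_box y hr hR, ENNReal.toReal_ofReal (by positivity)]

end StratifiedGroup

/-! ### Critical points of a homogeneous norm -/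

theorem eq_fderiv_of_pos_homogeneous {E F : Type*} [NormedAddCommGroup E] [NormedSpace ℝ E]
    [NormedAddCommGroup F] [NormedSpace ℝ F] {f : E → F} (hf : DifferentiableAt ℝ f 0)
    (hom : ∀ t : ℝ, 0 < t → ∀ z, f (t • z) = t • f z) : f = fderiv ℝ f 0 := by
  funext z
  have hf0 : f 0 = 0 := by
    have h2 := hom 2 two_pos 0
    rw [smul_zero, two_smul] at h2
    exact left_eq_add.1 h2
  have hray : HasDerivAt (fun t : ℝ => t • z) z 0 := by
    simpa using (hasDerivAt_id (0 : ℝ)).smul_const z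
  have hline : HasDerivAt (fun t : ℝ => t • f z) (f z) 0 := by
    simpa using (hasDerivAt_id (0 : ℝ)).smul_const (f z)
  have hf' : HasFDerivAt f (fderiv ℝ f 0) ((0 : ℝ) • z) := by
    rw [zero_smul]
    exact hf.hasFDerivAt
  have hcomp : HasDerivWithinAt (fun t : ℝ => t • f z) (fderiv ℝ f 0 z) (Set.Ici 0) 0 := by
    refine (hf'.comp_hasDerivAt 0 hray).hasDerivWithinAt.congr (fun t ht => ?_) (by simp [hf0])
    rcases (Set.mem_Ici.1 ht).eq_or_lt with rfl | ht
    · simp [hf0]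
    · exact (hom t ht z).symm
  exact (uniqueDiffOn_Ici (0 : ℝ) 0 Set.self_mem_Ici).eq_deriv _ hline.hasDerivWithinAt hcomp

theorem exists_contDiff_extension {E F : Type*} [NormedAddCommGroup E] [NormedSpace ℝ E]
    [FiniteDimensional ℝ E] [NormedAddCommGroup F] [NormedSpace ℝ F] {V : E → F}
    (hV : ∀ x, x ≠ 0 → ContDiffAt ℝ 1 V x) {φ : F →ₗ[ℝ] ℝ} (hφ : φ ≠ 0) (hφV : ∀ x, φ (V x) = 0) :
    ∃ P : E → F, ContDiff ℝ 1 P ∧ (∀ x, 2 ≤ ‖x‖ → P x = V x) ∧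
      ∀ x, P x = 0 → x ≠ 0 ∧ V x = 0 := by
  obtain ⟨v, hv⟩ := DFunLike.ne_iff.1 hφ
  let b : ContDiffBump (0 : E) := ⟨1, 2, one_pos, one_lt_two⟩
  have hb : ContDiff ℝ 1 b := b.contDiff
  refine ⟨fun x => (1 - b x) • V x + b x • v, contDiff_iff_contDiffAt.2 fun x => ?_,
    fun x hx => ?_, fun x hx => ?_⟩
  · rcases eq_or_ne x 0 with rfl | hx
    · refine (contDiffAt_const (c := v)).congr_of_eventuallyEq ?_
      filter_upwards [b.eventuallyEq_one] with x hx
      simp [hx]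
    · exact ((contDiffAt_const.sub hb.contDiffAt).smul (hV x hx)).add
        (hb.contDiffAt.smul contDiffAt_const)
  · have hbx : b x = 0 := b.zero_of_le_dist (by simpa [b] using hx)
    simp [hbx]
  · have hbx : b x = 0 := by
      have := congrArg φ hx
      simpa [hφV, show φ v ≠ 0 from hv] using this
    refine ⟨?_, by simpa [hbx] using hx⟩
    rintro rfl
    exact zero_ne_one (hbx.symm.trans (b.one_of_mem_closedBall (by simp [b])))

section EulerField

variable {d : ℕ} {w : Fin d → ℕ}

/-- The Euler field `∑ wᵢ xᵢ ∂/∂xᵢ`, the generator of the dilations. -/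
def eulerField (w : Fin d → ℕ) (x : Fin d → ℝ) : Fin d → ℝ := fun i => w i * x i

theorem hasDerivAt_dilation_one (w : Fin d → ℕ) (x : Fin d → ℝ) :
    HasDerivAt (fun t : ℝ => dilation w t x) (eulerField w x) 1 := by
  rw [hasDerivAt_pi]
  intro i
  have hpow := (hasDerivAt_pow (w i) (1 : ℝ)).mul_const (x i)
  rwa [one_pow, mul_one] at hpow

theorem contDiff_eulerField (w : Fin d → ℕ) {n : WithTop ℕ∞} : ContDiff ℝ n (eulerField w) :=
  contDiff_pi.2 fun i => contDiff_const.mul (contDiff_apply ℝ ℝ i)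

theorem exists_eq_zero_of_eq_eulerField_off_ball (hw : ∀ i, 1 ≤ w i)
    {W : (Fin d → ℝ) → (Fin d → ℝ)} (hW : ContDiff ℝ 1 W) {r : ℝ}
    (hr : ∀ x, r ≤ ‖x‖ → W x = eulerField w x) : ∃ x, W x = 0 := by
  have hw0 : ∀ i, (w i : ℝ) ≠ 0 := fun i => Nat.cast_ne_zero.2 (Nat.one_le_iff_ne_zero.1 (hw i))
  obtain ⟨x, hx⟩ := exists_eq_zero_of_eq_id_off_ball
    (g := fun x i => (w i : ℝ)⁻¹ * W x i)
    (contDiff_pi.2 fun i => contDiff_const.mul (contDiff_pi.1 hW i)) (r := r) fun x hx => by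
      funext i
      simp [hr x hx, eulerField, inv_mul_cancel_left₀ (hw0 i)]
  exact ⟨x, funext fun i => by simpa [hw0 i] using congrFun hx i⟩

end EulerField

namespace StratifiedGroup

variable {d : ℕ} {G : StratifiedGroup d} {N : (Fin d → ℝ) → ℝ}

theorem mul_eq_add_of_weight_eq_one (hw : ∀ i, G.weight i = 1) (x y : Fin d → ℝ) :
    G.mul x y = x + y := by
  have hdil : ∀ t x, dilation G.weight t x = t • x := fun t x => by
    funext i
    simp [dilation, hw]
  set f := fun z : (Fin d → ℝ) × (Fin d → ℝ) => G.mul z.1 z.2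
  have hlin : f = fderiv ℝ f 0 :=
    eq_fderiv_of_pos_homogeneous (G.contDiff_mul.differentiable (by simp) 0) fun t ht z => by
      simpa only [hdil] using! (G.dilation_mul t ht z.1 z.2).symm
  calc G.mul x y = f ((x, 0) + (0, y)) := by simp [f]
    _ = f (x, 0) + f (0, y) := by rw [hlin, map_add]
    _ = x + y := by simp [f, G.mul_zero, G.zero_mul]

theorem Noncommutative.exists_weight_ne_one (hG : G.Noncommutative) : ∃ j, G.weight j ≠ 1 := by
  by_contra! hw
  obtain ⟨x, y, hxy⟩ := hG
  exact hxy (by rw [mul_eq_add_of_weight_eq_one hw, mul_eq_add_of_weight_eq_one hw, add_comm])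

/-- The coordinates of the sub-gradient of `f` in the frame `X_i`, with the entries outside the
first layer set to zero. -/
def horizontalGrad (G : StratifiedGroup d) (f : (Fin d → ℝ) → ℝ) (x : Fin d → ℝ) : Fin d → ℝ :=
  fun i => if G.weight i = 1 then fderiv ℝ f x (leftField G.mul i x) else 0

theorem contDiffAt_horizontalGrad {f : (Fin d → ℝ) → ℝ} {x : Fin d → ℝ}
    (hf : ContDiffAt ℝ ∞ f x) : ContDiffAt ℝ 1 (G.horizontalGrad f) x := by
  rw [contDiffAt_pi]
  intro i
  by_cases hi : G.weight i = 1
  · simp only [horizontalGrad, hi, if_true, leftField_eq_frame]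
    have hf' : ContDiffAt ℝ 1 (fderiv ℝ f) x := hf.fderiv_right (by norm_cast)
    have hframe : ContDiff ℝ 1 G.frame := G.contDiff_frame.of_le (by norm_cast)
    exact hf'.clm_apply (hframe.clm_apply contDiff_const).contDiffAt
  · simp only [horizontalGrad, hi, if_false]
    exact contDiffAt_const

theorem fderiv_frame_horizontalGrad (G : StratifiedGroup d) (f : (Fin d → ℝ) → ℝ)
    (x : Fin d → ℝ) :
    fderiv ℝ f x (G.frame x (G.horizontalGrad f x)) = ∑ i, G.horizontalGrad f x i ^ 2 := by
  conv_lhs => rw [pi_eq_sum_univ' (G.horizontalGrad f x)]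
  rw [map_sum, map_sum]
  refine Finset.sum_congr rfl fun i _ => ?_
  rw [map_smul, map_smul, ← leftField_eq_frame]
  by_cases hi : G.weight i = 1 <;> simp [horizontalGrad, hi, sq]

-- Otherwise the homotopy from the Euler field to `V` (read in the frame `X_i`), which is nowhere
-- zero, would extend to the origin, because `V` avoids the directions outside the kernel of `φ`.
theorem exists_eulerField_add_frame_eq_zero (G : StratifiedGroup d)
    {V : (Fin d → ℝ) → (Fin d → ℝ)} (hV : ∀ x, x ≠ 0 → ContDiffAt ℝ 1 V x)
    {φ : (Fin d → ℝ) →ₗ[ℝ] ℝ} (hφ : φ ≠ 0) (hφV : ∀ x, φ (V x) = 0) :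
    ∃ x, x ≠ 0 ∧ ∃ s ∈ Set.Icc (0 : ℝ) 1,
      (1 - s) • eulerField G.weight x + s • G.frame x (V x) = 0 := by
  obtain ⟨P, hP, hPV, hP0⟩ := exists_contDiff_extension hV hφ hφV
  let s : ContDiffBump (0 : Fin d → ℝ) := ⟨2, 3, two_pos, by norm_num⟩
  have hs : ContDiff ℝ 1 s := s.contDiff
  have hframe : ContDiff ℝ 1 G.frame := G.contDiff_frame.of_le (by norm_cast)
  obtain ⟨x, hx⟩ := exists_eq_zero_of_eq_eulerField_off_ball G.weight_pos (r := 3)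
    (W := fun x => (1 - s x) • eulerField G.weight x + s x • G.frame x (P x))
    (((contDiff_const.sub hs).smul (contDiff_eulerField G.weight)).add
      (hs.smul (hframe.clm_apply hP))) fun x hx => by
        have hsx : s x = 0 := s.zero_of_le_dist (by simpa [s] using hx)
        simp [hsx]
  rcases le_or_gt ‖x‖ 2 with h2 | h2
  · have hsx : s x = 1 := s.one_of_mem_closedBall (by simpa [s] using h2)
    have hPx : P x = 0 := G.frame_injective x (by simpa [hsx] using hx)
    obtain ⟨hx0, hVx⟩ := hP0 x hPx
    exact ⟨x, hx0, 1, by simp, by simp [hVx]⟩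
  · rw [hPV x h2.le] at hx
    exact ⟨x, norm_pos_iff.1 (two_pos.trans h2), s x, ⟨s.nonneg, s.le_one⟩, hx⟩

namespace IsSmoothHomogeneousNorm

theorem pos (hN : G.IsSmoothHomogeneousNorm N) {x : Fin d → ℝ} (hx : x ≠ 0) : 0 < N x :=
  (hN.nonneg x).lt_of_ne fun h => hx ((hN.eq_zero_iff x).1 h.symm)

theorem contDiffAt (hN : G.IsSmoothHomogeneousNorm N) {x : Fin d → ℝ} (hx : x ≠ 0) :
    ContDiffAt ℝ ∞ N x :=
  hN.smooth.contDiffAt (isOpen_compl_singleton.mem_nhds hx)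

theorem fderiv_eulerField (hN : G.IsSmoothHomogeneousNorm N) {x : Fin d → ℝ} (hx : x ≠ 0) :
    fderiv ℝ N x (eulerField G.weight x) = N x := by
  have hd : HasFDerivAt N (fderiv ℝ N x) (dilation G.weight 1 x) := by
    rw [dilation_one]
    exact ((hN.contDiffAt hx).differentiableAt (by simp)).hasFDerivAt
  have hscale : HasDerivAt (fun t : ℝ => t * N x) (N x) 1 := by
    simpa using (hasDerivAt_id (1 : ℝ)).mul_const (N x)
  refine (hd.comp_hasDerivAt 1 (hasDerivAt_dilation_one _ x)).unique
    (hscale.congr_of_eventuallyEq ?_)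
  filter_upwards [lt_mem_nhds (zero_lt_one : (0 : ℝ) < 1)] with t ht
  exact hN.homogeneous t ht x

theorem exists_horizontalGrad_eq_zero (hN : G.IsSmoothHomogeneousNorm N)
    (hG : G.Noncommutative) : ∃ x, x ≠ 0 ∧ G.horizontalGrad N x = 0 := by
  obtain ⟨j, hj⟩ := hG.exists_weight_ne_one
  have hφ : (LinearMap.proj j : (Fin d → ℝ) →ₗ[ℝ] ℝ) ≠ 0 :=
    DFunLike.ne_iff.2 ⟨Pi.single j 1, by simp⟩
  obtain ⟨x, hx, s, ⟨hs0, hs1⟩, hzero⟩ := G.exists_eulerField_add_frame_eq_zero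
    (V := G.horizontalGrad N) (fun x hx => contDiffAt_horizontalGrad (hN.contDiffAt hx)) hφ
    fun x => by simp [horizontalGrad, hj]
  set S := ∑ i, G.horizontalGrad N x i ^ 2 with hS
  have hS0 : 0 ≤ S := Finset.sum_nonneg fun i _ => sq_nonneg _
  have hderiv : (1 - s) * N x + s * S = 0 := by
    have := congrArg (fderiv ℝ N x) hzero
    simpa only [map_add, map_smul, hN.fderiv_eulerField hx, fderiv_frame_horizontalGrad, map_zero,
      smul_eq_mul] using this
  obtain ⟨hN0, hsS⟩ := (add_eq_zero_iff_of_nonneg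
    (mul_nonneg (sub_nonneg.2 hs1) (hN.nonneg x)) (mul_nonneg hs0 hS0)).1 hderiv
  have hs : s = 1 :=
    (sub_eq_zero.1 ((mul_eq_zero.1 hN0).resolve_right (hN.pos hx).ne')).symm
  rw [hs, _root_.one_mul, hS, Finset.sum_eq_zero_iff_of_nonneg fun i _ => sq_nonneg _] at hsS
  exact ⟨x, hx, funext fun i => pow_eq_zero_iff two_ne_zero |>.1 (hsS i (Finset.mem_univ i))⟩

end IsSmoothHomogeneousNorm

end StratifiedGroup

/-! ### The Gibbs measure -/

theorem integrable_exp_neg_mul_norm_rpow {E : Type*} [NormedAddCommGroup E] [NormedSpace ℝ E]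
    [FiniteDimensional ℝ E] [MeasurableSpace E] [BorelSpace E] (μ : Measure E) [μ.IsAddHaarMeasure]
    {a γ : ℝ} (ha : 0 < a) (hγ : 0 < γ) : Integrable (fun x : E => Real.exp (-a * ‖x‖ ^ γ)) μ := by
  rcases subsingleton_or_nontrivial E with hE | hE
  · exact Continuous.integrable_of_hasCompactSupport continuous_of_discreteTopology
      (HasCompactSupport.of_compactSpace _)
  · rw [integrable_fun_norm_addHaar μ (f := fun u => Real.exp (-a * u ^ γ))]
    refine (integrableOn_rpow_mul_exp_neg_mul_rpow (s := (Module.finrank ℝ E - 1 : ℕ))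
      (neg_one_lt_zero.trans_le (Nat.cast_nonneg _)) hγ ha).congr_fun (fun u _ => ?_)
      measurableSet_Ioi
    simp only [Real.rpow_natCast, smul_eq_mul]

section Gibbs

variable {d : ℕ} {N : (Fin d → ℝ) → ℝ} {α p : ℝ} {s : Set (Fin d → ℝ)}

theorem gibbsMeasure_apply (hi : Integrable fun x => Real.exp (-α * N x ^ p))
    (hs : MeasurableSet s) :
    gibbsMeasure N α p s = ENNReal.ofReal
      ((∫ x, Real.exp (-α * N x ^ p))⁻¹ * ∫ x in s, Real.exp (-α * N x ^ p)) := by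
  have hZ : 0 < ∫ x, Real.exp (-α * N x ^ p) := integral_exp_pos hi
  rw [gibbsMeasure, Measure.smul_apply, withDensity_apply _ hs, smul_eq_mul,
    ← ofReal_integral_eq_lintegral_ofReal hi (Filter.Eventually.of_forall fun x => by positivity),
    ← ofReal_integral_eq_lintegral_ofReal hi.integrableOn
      (Filter.Eventually.of_forall fun x => by positivity),
    ENNReal.ofReal_mul (by positivity), ENNReal.ofReal_inv_of_pos hZ]

theorem isProbabilityMeasure_gibbsMeasure (hi : Integrable fun x => Real.exp (-α * N x ^ p)) :
    IsProbabilityMeasure (gibbsMeasure N α p) := by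
  have hZ : 0 < ∫ x, Real.exp (-α * N x ^ p) := integral_exp_pos hi
  refine ⟨?_⟩
  rw [gibbsMeasure_apply hi MeasurableSet.univ, Measure.restrict_univ, inv_mul_cancel₀ hZ.ne',
    ENNReal.ofReal_one]

theorem gibbsMeasure_real (hi : Integrable fun x => Real.exp (-α * N x ^ p))
    (hs : MeasurableSet s) :
    (gibbsMeasure N α p).real s =
      (∫ x, Real.exp (-α * N x ^ p))⁻¹ * ∫ x in s, Real.exp (-α * N x ^ p) := by
  have hZ : 0 < ∫ x, Real.exp (-α * N x ^ p) := integral_exp_pos hi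
  rw [Measure.real, gibbsMeasure_apply hi hs, ENNReal.toReal_ofReal]
  exact mul_nonneg (inv_pos.2 hZ).le (setIntegral_nonneg hs fun x _ => (Real.exp_pos _).le)

theorem gibbsMeasure_real_le (hi : Integrable fun x => Real.exp (-α * N x ^ p)) (hα : 0 ≤ α)
    (hs : MeasurableSet s) (hv : volume s ≠ ⊤) {c : ℝ} (h : ∀ x ∈ s, c ≤ N x ^ p) :
    (gibbsMeasure N α p).real s ≤
      (∫ x, Real.exp (-α * N x ^ p))⁻¹ * (Real.exp (-α * c) * volume.real s) := by
  have hZ := integral_exp_pos hi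
  rw [gibbsMeasure_real hi hs]
  gcongr
  calc ∫ x in s, Real.exp (-α * N x ^ p) ≤ ∫ _ in s, Real.exp (-α * c) :=
        setIntegral_mono_on hi.integrableOn (integrableOn_const hv) hs fun x hx =>
          Real.exp_le_exp.2 (mul_le_mul_of_nonpos_left (h x hx) (neg_nonpos.2 hα))
    _ = Real.exp (-α * c) * volume.real s := by rw [setIntegral_const, smul_eq_mul, mul_comm]

theorem le_gibbsMeasure_real (hi : Integrable fun x => Real.exp (-α * N x ^ p)) (hα : 0 ≤ α)
    (hs : MeasurableSet s) (hv : volume s ≠ ⊤) {c : ℝ} (h : ∀ x ∈ s, N x ^ p ≤ c) :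
    (∫ x, Real.exp (-α * N x ^ p))⁻¹ * (Real.exp (-α * c) * volume.real s) ≤
      (gibbsMeasure N α p).real s := by
  have hZ := integral_exp_pos hi
  rw [gibbsMeasure_real hi hs]
  gcongr
  calc Real.exp (-α * c) * volume.real s = ∫ _ in s, Real.exp (-α * c) := by
        rw [setIntegral_const, smul_eq_mul, mul_comm]
    _ ≤ ∫ x in s, Real.exp (-α * N x ^ p) :=
        setIntegral_mono_on (integrableOn_const hv) hi.integrableOn hs fun x hx =>
          Real.exp_le_exp.2 (mul_le_mul_of_nonpos_left (h x hx) (neg_nonpos.2 hα))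

theorem gibbsMeasure_real_le_mul_gibbsMeasure_real
    (hi : Integrable fun x => Real.exp (-α * N x ^ p)) (hα : 0 ≤ α) {s₁ s₂ : Set (Fin d → ℝ)}
    (hs₁ : MeasurableSet s₁) (hs₂ : MeasurableSet s₂) (hv₁ : volume s₁ ≠ ⊤) (hv₂ : volume s₂ ≠ ⊤)
    {Λ : ℝ} (hΛ : 0 ≤ Λ) (hv : volume.real s₂ ≤ Λ * volume.real s₁) {M B : ℝ}
    (h₁ : ∀ x ∈ s₁, N x ^ p ≤ M + B) (h₂ : ∀ x ∈ s₂, M - B ≤ N x ^ p) :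
    (gibbsMeasure N α p).real s₂ ≤
      Real.exp (2 * α * B) * Λ * (gibbsMeasure N α p).real s₁ := by
  have hZ := integral_exp_pos hi
  set Z := ∫ x, Real.exp (-α * N x ^ p)
  calc (gibbsMeasure N α p).real s₂
      ≤ Z⁻¹ * (Real.exp (-α * (M - B)) * volume.real s₂) := gibbsMeasure_real_le hi hα hs₂ hv₂ h₂
    _ ≤ Z⁻¹ * (Real.exp (-α * (M - B)) * (Λ * volume.real s₁)) := by gcongr
    _ = Real.exp (2 * α * B) * Λ * (Z⁻¹ * (Real.exp (-α * (M + B)) * volume.real s₁)) := by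
        rw [show -α * (M - B) = 2 * α * B + -α * (M + B) by ring, Real.exp_add]
        ring
    _ ≤ Real.exp (2 * α * B) * Λ * (gibbsMeasure N α p).real s₁ := by
        gcongr
        exact le_gibbsMeasure_real hi hα hs₁ hv₁ h₁

theorem gibbsMeasure_real_le_mul_exp (hi : Integrable fun x => Real.exp (-α * N x ^ p)) {a : ℝ}
    (hia : Integrable fun x => Real.exp (-a * N x ^ p)) (ha : a ≤ α) (hs : MeasurableSet s) {c : ℝ}
    (h : ∀ x ∈ s, c ≤ N x ^ p) :
    (gibbsMeasure N α p).real s ≤ (∫ x, Real.exp (-α * N x ^ p))⁻¹ *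
      (∫ x, Real.exp (-a * N x ^ p)) * Real.exp (-(α - a) * c) := by
  have hZ := integral_exp_pos hi
  rw [gibbsMeasure_real hi hs, mul_assoc]
  gcongr
  calc ∫ x in s, Real.exp (-α * N x ^ p)
      ≤ ∫ x in s, Real.exp (-a * N x ^ p) * Real.exp (-(α - a) * c) := by
        refine setIntegral_mono_on hi.integrableOn (hia.mul_const _).integrableOn hs fun x hx => ?_
        rw [← Real.exp_add]
        have hc : (α - a) * c ≤ (α - a) * N x ^ p :=
          mul_le_mul_of_nonneg_left (h x hx) (sub_nonneg.2 ha)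
        exact Real.exp_le_exp.2 (by linarith)
    _ ≤ ∫ x, Real.exp (-a * N x ^ p) * Real.exp (-(α - a) * c) :=
        setIntegral_le_integral (hia.mul_const _)
          (Filter.Eventually.of_forall fun x => by positivity)
    _ = _ := integral_mul_const _ _

end Gibbs

theorem exists_norm_dilation_eq_one {d : ℕ} {w : Fin d → ℕ} (hw : ∀ i, 1 ≤ w i) {x : Fin d → ℝ}
    (hx : 1 ≤ ‖x‖) : ∃ t ∈ Set.Ioc (0 : ℝ) 1, ‖dilation w t x‖ = 1 := by
  obtain ⟨t, ht, htx⟩ := intermediate_value_Icc zero_le_one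
    (continuous_dilation_left w x).norm.continuousOn (show (1 : ℝ) ∈ _ by
      rw [dilation_zero_left hw, dilation_one, norm_zero]
      exact ⟨zero_le_one, hx⟩)
  refine ⟨t, ⟨ht.1.lt_of_ne ?_, ht.2⟩, htx⟩
  rintro rfl
  simp [dilation_zero_left hw] at htx

namespace StratifiedGroup.IsSmoothHomogeneousNorm

variable {d : ℕ} {G : StratifiedGroup d} {N : (Fin d → ℝ) → ℝ}

theorem exists_mul_norm_rpow_le (hN : G.IsSmoothHomogeneousNorm N) :
    ∃ c > 0, ∃ γ : ℝ, 0 < γ ∧ ∀ x, 1 ≤ ‖x‖ → c * ‖x‖ ^ γ ≤ N x := by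
  obtain ⟨c, hc, hcN⟩ : ∃ c, 0 < c ∧ ∀ y ∈ Metric.sphere (0 : Fin d → ℝ) 1, c ≤ N y :=
    (isCompact_sphere 0 1).exists_forall_le' hN.continuous.continuousOn fun y hy =>
      hN.pos (ne_zero_of_mem_unit_sphere ⟨y, hy⟩)
  set Q := homogeneousDim G.weight
  refine ⟨c, hc, ((Q + 1 : ℕ) : ℝ)⁻¹, by positivity, fun x hx => ?_⟩
  obtain ⟨t, ⟨ht0, ht1⟩, htx⟩ := exists_norm_dilation_eq_one G.weight_pos hx
  have ht : 1 ≤ t⁻¹ := (one_le_inv₀ ht0).2 ht1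
  have hx' : dilation G.weight t⁻¹ (dilation G.weight t x) = x :=
    dilation_inv_dilation G.weight ht0.ne' x
  have hnorm : ‖x‖ ≤ t⁻¹ ^ (Q + 1) := by
    calc ‖x‖ ≤ t⁻¹ ^ Q * 1 := by
          rw [← htx]
          conv_lhs => rw [← hx']
          exact norm_dilation_le_pow_mul ht _
      _ ≤ t⁻¹ ^ (Q + 1) := by
          rw [_root_.mul_one]
          exact pow_le_pow_right₀ ht (Nat.le_succ Q)
  calc c * ‖x‖ ^ ((Q + 1 : ℕ) : ℝ)⁻¹ ≤ c * (t⁻¹ ^ (Q + 1)) ^ ((Q + 1 : ℕ) : ℝ)⁻¹ := by gcongr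
    _ = t⁻¹ * c := by
        rw [Real.pow_rpow_inv_natCast (by positivity) (Nat.succ_ne_zero Q), mul_comm]
    _ ≤ t⁻¹ * N (dilation G.weight t x) := by
        gcongr
        exact hcN _ (mem_sphere_zero_iff_norm.2 htx)
    _ = N x := by rw [← hN.homogeneous _ (by positivity), hx']

theorem integrable_exp (hN : G.IsSmoothHomogeneousNorm N) {α p : ℝ} (hα : 0 < α) (hp : 0 < p) :
    Integrable fun x => Real.exp (-α * N x ^ p) := by
  obtain ⟨c, hc, γ, hγ, hcN⟩ := hN.exists_mul_norm_rpow_le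
  set a := α * c ^ p with ha
  have ha0 : 0 < a := by positivity
  refine ((integrable_exp_neg_mul_norm_rpow volume ha0 (mul_pos hγ hp)).const_mul
    (Real.exp a)).mono' ?_ (Filter.Eventually.of_forall fun x => ?_)
  · exact (Real.continuous_exp.comp (continuous_const.mul
      (hN.continuous.rpow_const fun x => Or.inr hp.le))).aestronglyMeasurable
  rw [Real.norm_of_nonneg (Real.exp_pos _).le, ← Real.exp_add, Real.exp_le_exp]
  suffices h : a * ‖x‖ ^ (γ * p) ≤ a + α * N x ^ p by linarith
  rcases le_total ‖x‖ 1 with hx | hx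
  · calc a * ‖x‖ ^ (γ * p) ≤ a * 1 := by
          gcongr
          exact Real.rpow_le_one (norm_nonneg x) hx (by positivity)
      _ ≤ a + α * N x ^ p := by
          have := Real.rpow_nonneg (hN.nonneg x) p
          nlinarith
  · calc a * ‖x‖ ^ (γ * p) = α * (c * ‖x‖ ^ γ) ^ p := by
          rw [Real.mul_rpow hc.le (by positivity), Real.rpow_mul (norm_nonneg x), ha,
            _root_.mul_assoc]
      _ ≤ α * N x ^ p := by
          gcongr
          exact hcN x hx
      _ ≤ a + α * N x ^ p := le_add_of_nonneg_left ha0.le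

end StratifiedGroup.IsSmoothHomogeneousNorm

/-! ### Oscillation along the dilates of a critical point -/

theorem sub_sub_fderiv_isBigO_norm_sub_sq {E F : Type*} [NormedAddCommGroup E] [NormedSpace ℝ E]
    [NormedAddCommGroup F] [NormedSpace ℝ F] {f : E → F} {x : E} (hf : ContDiffAt ℝ 2 f x) :
    (fun y => f y - f x - fderiv ℝ f x (y - x)) =O[nhds x] fun y => ‖y - x‖ ^ 2 := by
  have hf' : ContDiffAt ℝ 1 (fderiv ℝ f) x := hf.fderiv_right (by norm_num)
  obtain ⟨C, hC, hO⟩ := (hf'.differentiableAt one_ne_zero).isBigO_sub.exists_pos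
  have hdiff : ∀ᶠ y in nhds x, DifferentiableAt ℝ f y := by
    filter_upwards [hf.eventually (by simp)] with y hy using hy.differentiableAt (by simp)
  obtain ⟨δ, hδ, hball⟩ := Metric.eventually_nhds_iff_ball.1 (hO.bound.and hdiff)
  refine Asymptotics.IsBigO.of_bound C ?_
  filter_upwards [Metric.ball_mem_nhds x hδ] with y hy
  have hsub : ∀ z ∈ Metric.closedBall x ‖y - x‖, z ∈ Metric.ball x δ := fun z hz =>
    lt_of_le_of_lt hz (by rwa [Metric.mem_ball, dist_eq_norm] at hy)
  have hbound := Convex.norm_image_sub_le_of_norm_hasFDerivWithin_le' (𝕜 := ℝ) (f := f)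
    (f' := fderiv ℝ f) (φ := fderiv ℝ f x) (s := Metric.closedBall x ‖y - x‖)
    (C := C * ‖y - x‖) (x := x) (y := y)
    (fun z hz => (hball z (hsub z hz)).2.hasFDerivAt.hasFDerivWithinAt)
    (fun z hz => (hball z (hsub z hz)).1.trans
      (mul_le_mul_of_nonneg_left (mem_closedBall_iff_norm.1 hz) hC.le))
    (convex_closedBall _ _) (Metric.mem_closedBall_self (norm_nonneg _))
    (mem_closedBall_iff_norm.2 le_rfl)
  rwa [norm_pow, norm_norm, sq, ← mul_assoc]

section DilationTaylor

variable {d : ℕ} {w : Fin d → ℕ} {F : Type*} [NormedAddCommGroup F] [NormedSpace ℝ F]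

theorem norm_clm_dilation_le (hw : ∀ i, 1 ≤ w i) {L : (Fin d → ℝ) →L[ℝ] F}
    (hL : ∀ i, w i = 1 → L (Pi.single i 1) = 0) {t : ℝ} (ht : t ∈ Set.Icc 0 1) (k : Fin d → ℝ) :
    ‖L (dilation w t k)‖ ≤ ‖L‖ * (t ^ 2 * ‖k‖) := by
  set v : Fin d → ℝ := fun i => if w i = 1 then 0 else dilation w t k i
  have hLv : L (dilation w t k) = L v := by
    rw [pi_eq_sum_univ' (dilation w t k), pi_eq_sum_univ' v, map_sum, map_sum]
    refine Finset.sum_congr rfl fun i _ => ?_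
    rw [map_smul, map_smul]
    by_cases hi : w i = 1
    · rw [hL i hi, smul_zero, smul_zero]
    · simp only [v, hi, if_false]
  have hv : ‖v‖ ≤ t ^ 2 * ‖k‖ := by
    refine (pi_norm_le_iff_of_nonneg (by positivity)).2 fun i => ?_
    by_cases hi : w i = 1
    · simp only [v, hi, if_true, norm_zero]
      positivity
    · simp only [v, hi, if_false]
      rw [dilation, norm_mul, norm_pow, Real.norm_of_nonneg ht.1]
      have hi2 : 2 ≤ w i := (hw i).lt_of_ne' hi
      exact mul_le_mul (pow_le_pow_of_le_one ht.1 ht.2 hi2) (norm_le_pi_norm k i)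
        (norm_nonneg _) (sq_nonneg t)
  rw [hLv]
  exact (L.le_opNorm v).trans (by gcongr)

theorem exists_norm_comp_dilation_sub_le (hw : ∀ i, 1 ≤ w i) {f : (Fin d → ℝ) → F}
    (hf : ContDiffAt ℝ 2 f 0) (hf₁ : ∀ i, w i = 1 → fderiv ℝ f 0 (Pi.single i 1) = 0) (R : ℝ) :
    ∃ C, ∀ᶠ ε in nhdsWithin (0 : ℝ) (Set.Ioi 0), ∀ k, ‖k‖ ≤ R →
      ‖f (dilation w ε k) - f 0‖ ≤ C * ε ^ 2 := by
  obtain ⟨C, hC, hO⟩ := (sub_sub_fderiv_isBigO_norm_sub_sq hf).exists_pos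
  obtain ⟨δ, hδ, hball⟩ := Metric.eventually_nhds_iff_ball.1 hO.bound
  refine ⟨C * R ^ 2 + ‖fderiv ℝ f 0‖ * R, ?_⟩
  have hsmall : ∀ᶠ ε in nhdsWithin (0 : ℝ) (Set.Ioi 0), ε * R < δ :=
    nhdsWithin_le_nhds <|
      ((continuous_mul_const R).tendsto' 0 0 (zero_mul R)).eventually_lt_const hδ
  filter_upwards [hsmall, Ioc_mem_nhdsGT one_pos] with ε hεR hε k hk
  have hε' : ε ∈ Set.Icc (0 : ℝ) 1 := ⟨hε.1.le, hε.2⟩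
  have hnorm : ‖dilation w ε k‖ ≤ ε * R :=
    (norm_dilation_le_mul hw hε' k).trans (mul_le_mul_of_nonneg_left hk hε.1.le)
  have hquad := hball _ (mem_ball_zero_iff.2 (hnorm.trans_lt hεR))
  rw [sub_zero, norm_pow, norm_norm] at hquad
  calc ‖f (dilation w ε k) - f 0‖
      = ‖(f (dilation w ε k) - f 0 - fderiv ℝ f 0 (dilation w ε k)) +
          fderiv ℝ f 0 (dilation w ε k)‖ := by rw [sub_add_cancel]
    _ ≤ C * (ε * R) ^ 2 + ‖fderiv ℝ f 0‖ * (ε ^ 2 * R) :=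
        (norm_add_le _ _).trans <| add_le_add (hquad.trans (by gcongr)) <|
          (norm_clm_dilation_le hw hf₁ hε' k).trans (by gcongr)
    _ = (C * R ^ 2 + ‖fderiv ℝ f 0‖ * R) * ε ^ 2 := by ring

end DilationTaylor

namespace StratifiedGroup.IsSmoothHomogeneousNorm

variable {d : ℕ} {G : StratifiedGroup d} {N : (Fin d → ℝ) → ℝ} {x : Fin d → ℝ}

theorem contDiffAt_rpow_mul (hN : G.IsSmoothHomogeneousNorm N) (hx : x ≠ 0) (p : ℝ) :
    ContDiffAt ℝ ∞ (fun z => N (G.mul x z) ^ p) 0 := by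
  have hNx : ContDiffAt ℝ ∞ N (G.mul x 0) := by
    rw [G.mul_zero]
    exact hN.contDiffAt hx
  refine (hNx.comp 0 (G.contDiff_mul_left x).contDiffAt).rpow_const_of_ne ?_
  rw [Function.comp_apply, G.mul_zero]
  exact (hN.pos hx).ne'

theorem fderiv_rpow_mul_eq_zero (hN : G.IsSmoothHomogeneousNorm N) (hx : x ≠ 0)
    (hcrit : G.horizontalGrad N x = 0) (p : ℝ) {i : Fin d} (hi : G.weight i = 1) :
    fderiv ℝ (fun z => N (G.mul x z) ^ p) 0 (Pi.single i 1) = 0 := by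
  have hNx : HasFDerivAt N (fderiv ℝ N x) (G.mul x 0) := by
    rw [G.mul_zero]
    exact ((hN.contDiffAt hx).differentiableAt (by simp)).hasFDerivAt
  have hi0 : fderiv ℝ N x (G.frame x (Pi.single i 1)) = 0 := by
    simpa [horizontalGrad, hi, leftField_eq_frame] using congrFun hcrit i
  have hderiv : HasFDerivAt (fun z => N (G.mul x z) ^ p)
      ((p * N (G.mul x 0) ^ (p - 1)) • (fderiv ℝ N x).comp (G.frame x)) 0 := by
    refine (hNx.comp 0 (G.differentiable_mul_left x 0).hasFDerivAt).rpow_const (Or.inl ?_)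
    rw [Function.comp_apply, G.mul_zero]
    exact (hN.pos hx).ne'
  rw [hderiv.fderiv, smul_apply, ContinuousLinearMap.comp_apply, hi0, smul_zero]

theorem rpow_mul_dilation_mul (hN : G.IsSmoothHomogeneousNorm N) (p : ℝ) {t : ℝ} (ht : 0 < t)
    (ε : ℝ) (x k : Fin d → ℝ) :
    N (G.mul (dilation G.weight t x) (dilation G.weight (t * ε) k)) ^ p =
      t ^ p * N (G.mul x (dilation G.weight ε k)) ^ p := by
  rw [← dilation_dilation, ← G.dilation_mul t ht, hN.homogeneous t ht,
    Real.mul_rpow ht.le (hN.nonneg _)]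

-- The radius `t ^ (1 - p / 2)` is `t * ε` with `ε = t ^ (-(p / 2))`: the factor `t ^ p` from
-- homogeneity cancels the Taylor bound `ε ^ 2` at a critical point.
theorem exists_rpow_mul_dilation_sub_le (hN : G.IsSmoothHomogeneousNorm N) (hx : x ≠ 0)
    (hcrit : G.horizontalGrad N x = 0) {p : ℝ} (hp : 0 < p) (R : ℝ) :
    ∃ B, ∀ᶠ t : ℝ in Filter.atTop, ∀ k, ‖k‖ ≤ R →
      |N (G.mul (dilation G.weight t x) (dilation G.weight (t ^ (1 - p / 2)) k)) ^ p -
        t ^ p * N x ^ p| ≤ B := by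
  obtain ⟨B, hB⟩ := exists_norm_comp_dilation_sub_le G.weight_pos
    ((hN.contDiffAt_rpow_mul hx p).of_le (by norm_cast))
    (fun i hi => hN.fderiv_rpow_mul_eq_zero hx hcrit p hi) R
  have hlim : Filter.Tendsto (fun t : ℝ => t ^ (-(p / 2))) Filter.atTop
      (nhdsWithin 0 (Set.Ioi 0)) :=
    tendsto_nhdsWithin_iff.2 ⟨tendsto_rpow_neg_atTop (half_pos hp),
      (Filter.eventually_gt_atTop 0).mono fun t ht => Real.rpow_pos_of_pos ht _⟩
  refine ⟨B, ?_⟩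
  filter_upwards [hlim.eventually hB, Filter.eventually_gt_atTop 0] with t ht ht0 k hk
  have hr : t ^ (1 - p / 2) = t * t ^ (-(p / 2)) := by
    rw [sub_eq_add_neg, Real.rpow_add ht0, Real.rpow_one]
  have hone : t ^ p * (t ^ (-(p / 2))) ^ 2 = 1 := by
    rw [← Real.rpow_natCast, ← Real.rpow_mul ht0.le, ← Real.rpow_add ht0]
    norm_num
  have hk' := ht k hk
  rw [G.mul_zero, Real.norm_eq_abs] at hk'
  calc |N (G.mul (dilation G.weight t x) (dilation G.weight (t ^ (1 - p / 2)) k)) ^ p -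
        t ^ p * N x ^ p|
      = t ^ p * |N (G.mul x (dilation G.weight (t ^ (-(p / 2))) k)) ^ p - N x ^ p| := by
        rw [hr, hN.rpow_mul_dilation_mul p ht0, ← mul_sub, abs_mul, abs_of_pos (by positivity)]
    _ ≤ t ^ p * (B * (t ^ (-(p / 2))) ^ 2) := by gcongr
    _ = B := by rw [mul_left_comm, hone, _root_.mul_one]

theorem exists_abs_rpow_sub_le_of_mem_box (hN : G.IsSmoothHomogeneousNorm N)
    (hG : G.Noncommutative) {p : ℝ} (hp : 0 < p) (R : ℝ) :
    ∃ M > 0, ∃ B, ∀ᶠ t : ℝ in Filter.atTop, ∃ y, ∀ z ∈ G.box y (t ^ (1 - p / 2)) R,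
      |N z ^ p - t ^ p * M| ≤ B := by
  obtain ⟨x, hx, hcrit⟩ := hN.exists_horizontalGrad_eq_zero hG
  obtain ⟨B, hB⟩ := hN.exists_rpow_mul_dilation_sub_le hx hcrit hp R
  refine ⟨N x ^ p, Real.rpow_pos_of_pos (hN.pos hx) p, B, ?_⟩
  filter_upwards [hB, Filter.eventually_gt_atTop 0] with t ht ht0
  refine ⟨dilation G.weight t x, fun z hz => ?_⟩
  obtain ⟨k, hk, rfl⟩ := G.exists_eq_mul_dilation_of_mem_box (Real.rpow_pos_of_pos ht0 _).ne' hz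
  exact ht k hk

end StratifiedGroup.IsSmoothHomogeneousNorm

/-! ### Cutoff functions in the logarithmic Sobolev inequality -/

theorem integrable_rpow_and_integral_rpow_le {X : Type*} [TopologicalSpace X] [MeasurableSpace X]
    [OpensMeasurableSpace X] {μ : Measure X} [IsFiniteMeasure μ] {f : X → ℝ} (hf : Continuous f)
    {κ q : ℝ} (hq : 0 < q) (hf0 : ∀ x, 0 ≤ f x) (hfκ : ∀ x, f x ≤ κ) {s : Set X}
    (hfs : ∀ x, x ∉ s → f x = 0) :
    Integrable (fun x => f x ^ q) μ ∧ ∫ x, f x ^ q ∂μ ≤ κ ^ q * μ.real s := by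
  have hbound : ∀ x, ‖f x ^ q‖ ≤ κ ^ q := fun x => by
    rw [Real.norm_of_nonneg (Real.rpow_nonneg (hf0 x) q)]
    exact Real.rpow_le_rpow (hf0 x) (hfκ x) hq.le
  refine ⟨Integrable.of_bound (hf.rpow_const fun _ => Or.inr hq.le).aestronglyMeasurable (κ ^ q)
    (Filter.Eventually.of_forall hbound), ?_⟩
  rw [← setIntegral_eq_integral_of_forall_compl_eq_zero fun x hx => by
    rw [hfs x hx, Real.zero_rpow hq.ne']]
  exact (le_abs_self _).trans
    (norm_setIntegral_le_of_norm_le_const (measure_lt_top μ s) fun x _ => hbound x)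

theorem ofReal_rpow_mul_measureReal_le_lintegral {X : Type*} [MeasurableSpace X] {μ : Measure X}
    [IsFiniteMeasure μ] {g : X → ℝ} {s : Set X} (hs : MeasurableSet s) (hgs : ∀ x ∈ s, g x = 1)
    {m ℓ β : ℝ} (hβ : 0 ≤ β) (hℓ : 0 ≤ ℓ) (hm : 0 < m) (hmℓ : m ≤ Real.exp (-ℓ)) :
    ENNReal.ofReal (ℓ ^ β * μ.real s) ≤
      ∫⁻ x, ENNReal.ofReal (g x * |Real.log (g x / m)| ^ β) ∂μ := by
  have hlog : ℓ ≤ |Real.log (1 / m)| := by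
    rw [one_div, Real.log_inv, abs_neg]
    have hlogm : Real.log m ≤ -ℓ := (Real.log_le_iff_le_exp hm).2 hmℓ
    exact (le_neg.1 hlogm).trans (neg_le_abs _)
  calc ENNReal.ofReal (ℓ ^ β * μ.real s) = ∫⁻ _ in s, ENNReal.ofReal (ℓ ^ β) ∂μ := by
        rw [setLIntegral_const, ENNReal.ofReal_mul (by positivity), ofReal_measureReal]
    _ ≤ ∫⁻ x in s, ENNReal.ofReal (g x * |Real.log (g x / m)| ^ β) ∂μ := by
        refine setLIntegral_mono' hs fun x hx => ENNReal.ofReal_le_ofReal ?_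
        rw [hgs x hx, one_mul]
        exact Real.rpow_le_rpow hℓ hlog hβ
    _ ≤ ∫⁻ x, ENNReal.ofReal (g x * |Real.log (g x / m)| ^ β) ∂μ := setLIntegral_le_lintegral _ _

namespace StratifiedGroup

variable {d : ℕ} (G : StratifiedGroup d)

theorem fderiv_comp_rescale_leftField {f : (Fin d → ℝ) → ℝ} (hf : Differentiable ℝ f)
    (y : Fin d → ℝ) {r : ℝ} (hr : 0 < r) (x : Fin d → ℝ) {i : Fin d} (hi : G.weight i = 1) :
    fderiv ℝ (f ∘ G.rescale y r) x (leftField G.mul i x) =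
      r⁻¹ * fderiv ℝ f (G.rescale y r x) (leftField G.mul i (G.rescale y r x)) := by
  have hchain : fderiv ℝ (G.rescale y r) x =
      (dilationCLM G.weight r⁻¹).comp (fderiv ℝ (G.mul (G.inv y)) x) := by
    have hcomp : G.rescale y r = dilationCLM G.weight r⁻¹ ∘ G.mul (G.inv y) := rfl
    rw [hcomp, fderiv_comp _ (dilationCLM G.weight r⁻¹).differentiableAt
      (G.differentiable_mul_left _ x), ContinuousLinearMap.fderiv]
  have hinvariant : fderiv ℝ (G.mul (G.inv y)) x (G.frame x (Pi.single i 1)) =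
      G.frame (G.mul (G.inv y) x) (Pi.single i 1) :=
    DFunLike.congr_fun (G.fderiv_mul_comp_frame (G.inv y) x) (Pi.single i 1)
  have hhomogeneous : G.frame (G.rescale y r x) (dilation G.weight r⁻¹ (Pi.single i 1)) =
      dilation G.weight r⁻¹ (G.frame (G.mul (G.inv y) x) (Pi.single i 1)) :=
    DFunLike.congr_fun (G.frame_dilation_comp (inv_pos.2 hr) (G.mul (G.inv y) x)) (Pi.single i 1)
  rw [fderiv_comp _ (hf _) ((G.contDiff_rescale y r).differentiable (by simp) x),
    ContinuousLinearMap.comp_apply, hchain, ContinuousLinearMap.comp_apply, leftField_eq_frame,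
    hinvariant, dilationCLM_apply, ← hhomogeneous, dilation_single, hi, pow_one, map_smul,
    map_smul, smul_eq_mul, leftField_eq_frame]

theorem subgradNorm_comp_rescale {f : (Fin d → ℝ) → ℝ} (hf : Differentiable ℝ f)
    (y : Fin d → ℝ) {r : ℝ} (hr : 0 < r) (x : Fin d → ℝ) :
    G.subgradNorm (f ∘ G.rescale y r) x = r⁻¹ * G.subgradNorm f (G.rescale y r x) := by
  have hsum : ∑ i with G.weight i = 1, (fderiv ℝ (f ∘ G.rescale y r) x (leftField G.mul i x)) ^ 2 =
      r⁻¹ ^ 2 * ∑ i with G.weight i = 1,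
        (fderiv ℝ f (G.rescale y r x) (leftField G.mul i (G.rescale y r x))) ^ 2 := by
    rw [Finset.mul_sum]
    refine Finset.sum_congr rfl fun i hi => ?_
    rw [G.fderiv_comp_rescale_leftField hf y hr x (Finset.mem_filter.1 hi).2, mul_pow]
  rw [subgradNorm, subgradNorm, hsum, Real.sqrt_mul (by positivity),
    Real.sqrt_sq (by positivity)]

theorem subgradNorm_nonneg (f : (Fin d → ℝ) → ℝ) (x : Fin d → ℝ) : 0 ≤ G.subgradNorm f x :=
  Real.sqrt_nonneg _

theorem continuous_subgradNorm {f : (Fin d → ℝ) → ℝ} (hf : ContDiff ℝ 1 f) :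
    Continuous (G.subgradNorm f) := by
  refine Real.continuous_sqrt.comp (continuous_finsetSum _ fun i _ => ?_)
  exact ((hf.continuous_fderiv one_ne_zero).clm_apply
    (G.contDiff_frame.continuous.clm_apply continuous_const)).pow 2

theorem subgradNorm_eq_zero_of_notMem_tsupport {f : (Fin d → ℝ) → ℝ} {x : Fin d → ℝ}
    (hx : x ∉ tsupport f) : G.subgradNorm f x = 0 := by
  have hf : fderiv ℝ f x = 0 := by
    rw [(notMem_tsupport_iff_eventuallyEq.1 hx).fderiv_eq, fderiv_zero, Pi.zero_apply]
  simp [subgradNorm, hf]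

/-- A fixed smooth cutoff from the unit ball to the ball of radius two. -/
def unitBump (d : ℕ) : ContDiffBump (0 : Fin d → ℝ) := ⟨1, 2, one_pos, one_lt_two⟩

/-- The cutoff function from `G.box y r 1` to `G.box y r 2` which tests the logarithmic Sobolev
inequality. -/
def boxCutoff (y : Fin d → ℝ) (r : ℝ) : (Fin d → ℝ) → ℝ := unitBump d ∘ G.rescale y r

theorem contDiff_boxCutoff (y : Fin d → ℝ) (r : ℝ) : ContDiff ℝ 1 (G.boxCutoff y r) :=
  (unitBump d).contDiff.comp ((G.contDiff_rescale y r).of_le (by norm_cast))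

theorem boxCutoff_eq_one {y x : Fin d → ℝ} {r : ℝ} (hx : x ∈ G.box y r 1) :
    G.boxCutoff y r x = 1 :=
  (unitBump d).one_of_mem_closedBall hx

theorem boxCutoff_eq_zero {y x : Fin d → ℝ} {r : ℝ} (hx : x ∉ G.box y r 2) :
    G.boxCutoff y r x = 0 :=
  (unitBump d).zero_of_le_dist (not_le.1 hx).le

theorem subgradNorm_boxCutoff (y : Fin d → ℝ) {r : ℝ} (hr : 0 < r) (x : Fin d → ℝ) :
    G.subgradNorm (G.boxCutoff y r) x = r⁻¹ * G.subgradNorm (unitBump d) (G.rescale y r x) :=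
  G.subgradNorm_comp_rescale ((unitBump d).contDiff.differentiable one_ne_zero) y hr x

theorem subgradNorm_boxCutoff_eq_zero {y x : Fin d → ℝ} {r : ℝ} (hr : 0 < r)
    (hx : x ∉ G.box y r 2) : G.subgradNorm (G.boxCutoff y r) x = 0 := by
  have hsupp : G.rescale y r x ∉ tsupport (unitBump d) := by
    rwa [(unitBump d).tsupport_eq]
  rw [G.subgradNorm_boxCutoff y hr, G.subgradNorm_eq_zero_of_notMem_tsupport hsupp,
    MulZeroClass.mul_zero]

theorem exists_subgradNorm_boxCutoff_le :
    ∃ K ≥ 0, ∀ (y : Fin d → ℝ) (r : ℝ), 0 < r →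
      ∀ x, G.subgradNorm (G.boxCutoff y r) x ≤ r⁻¹ * K := by
  have hcpt : HasCompactSupport (G.subgradNorm (unitBump d)) :=
    HasCompactSupport.of_support_subset_isCompact (unitBump d).hasCompactSupport fun x hx =>
      not_not.1 fun h => hx (G.subgradNorm_eq_zero_of_notMem_tsupport h)
  obtain ⟨K, hK⟩ := hcpt.exists_bound_of_continuous
    (G.continuous_subgradNorm (unitBump d).contDiff)
  refine ⟨K, (norm_nonneg _).trans (hK 0), fun y r hr x => ?_⟩
  rw [G.subgradNorm_boxCutoff y hr]
  gcongr
  exact (le_abs_self _).trans (hK _)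

variable {G} in
theorem LogSobolev.exists_rpow_mul_measureReal_box_le {μ : Measure (Fin d → ℝ)}
    [IsProbabilityMeasure μ] {β q : ℝ} (h : G.LogSobolev μ β q) (hβ : 0 ≤ β) (hq : 0 < q) :
    ∃ C ≥ 0, ∃ D ≥ 0, ∀ (y : Fin d → ℝ) (r ℓ : ℝ), 0 < r → 0 ≤ ℓ → 0 < μ.real (G.box y r 1) →
      μ.real (G.box y r 2) ≤ Real.exp (-ℓ) →
      ℓ ^ β * μ.real (G.box y r 1) ≤ (C * r⁻¹ ^ q + D) * μ.real (G.box y r 2) := by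
  obtain ⟨C, D, hC, hD, h⟩ := h
  obtain ⟨K, hK, hgrad⟩ := G.exists_subgradNorm_boxCutoff_le
  refine ⟨C * K ^ q, by positivity, D, hD, fun y r ℓ hr hℓ hpos hsmall => ?_⟩
  set f := G.boxCutoff y r
  have hf : ContDiff ℝ 1 f := G.contDiff_boxCutoff y r
  obtain ⟨hint, hm⟩ := integrable_rpow_and_integral_rpow_le (μ := μ) hf.continuous.abs hq
    (fun _ => abs_nonneg _) (κ := 1)
    (fun x => (abs_of_nonneg (unitBump d).nonneg).trans_le (unitBump d).le_one)
    fun x hx => abs_eq_zero.2 (G.boxCutoff_eq_zero hx)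
  obtain ⟨hint', hm'⟩ := integrable_rpow_and_integral_rpow_le (μ := μ)
    (G.continuous_subgradNorm hf) hq (G.subgradNorm_nonneg f) (hgrad y r hr)
    fun x => G.subgradNorm_boxCutoff_eq_zero hr
  have hf1 : ∀ x ∈ G.box y r 1, |f x| ^ q = 1 := fun x hx => by
    rw [show f x = 1 from G.boxCutoff_eq_one hx, abs_one, Real.one_rpow]
  have hmpos : 0 < ∫ x, |f x| ^ q ∂μ := by
    calc 0 < μ.real (G.box y r 1) := hpos
      _ = ∫ x in G.box y r 1, |f x| ^ q ∂μ := by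
          rw [setIntegral_congr_fun (G.measurableSet_box y r 1) hf1, setIntegral_const, smul_eq_mul,
            _root_.mul_one]
      _ ≤ ∫ x, |f x| ^ q ∂μ := setIntegral_le_integral hint
          (Filter.Eventually.of_forall fun x => by positivity)
  rw [Real.one_rpow, _root_.one_mul] at hm
  have hLS := (ofReal_rpow_mul_measureReal_le_lintegral (G.measurableSet_box y r 1) hf1 hβ hℓ hmpos
    (hm.trans hsmall)).trans (h f hf.locallyLipschitz hint hint')
  have hgrad0 : 0 ≤ ∫ x, G.subgradNorm f x ^ q ∂μ :=
    integral_nonneg fun x => Real.rpow_nonneg (G.subgradNorm_nonneg f x) q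
  rw [ENNReal.ofReal_le_ofReal_iff (by positivity)] at hLS
  calc ℓ ^ β * μ.real (G.box y r 1)
      ≤ C * ∫ x, G.subgradNorm f x ^ q ∂μ + D * ∫ x, |f x| ^ q ∂μ := hLS
    _ ≤ C * ((r⁻¹ * K) ^ q * μ.real (G.box y r 2)) + D * μ.real (G.box y r 2) := by gcongr
    _ = (C * K ^ q * r⁻¹ ^ q + D) * μ.real (G.box y r 2) := by
        rw [Real.mul_rpow (by positivity) hK]
        ring

end StratifiedGroup

/-! ### Growth along the dilates of a critical point -/

theorem eventually_mul_exp_le_exp (K : ℝ) {a b : ℝ} (hab : a < b) :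
    ∀ᶠ u : ℝ in Filter.atTop, K * Real.exp (-(b * u)) ≤ Real.exp (-(a * u)) := by
  have hlim : Filter.Tendsto (fun u : ℝ => Real.exp ((b - a) * u)) Filter.atTop Filter.atTop :=
    Real.tendsto_exp_atTop.comp (Filter.tendsto_id.const_mul_atTop (sub_pos.2 hab))
  filter_upwards [hlim.eventually_ge_atTop K] with u hu
  calc K * Real.exp (-(b * u)) ≤ Real.exp ((b - a) * u) * Real.exp (-(b * u)) := by gcongr
    _ = Real.exp (-(a * u)) := by
      rw [← Real.exp_add]
      ring_nf

theorem not_eventually_mul_rpow_le {c A D γ δ : ℝ} (hc : 0 < c) (hδ : 0 < δ) (hγδ : γ < δ) :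
    ¬ ∀ᶠ t : ℝ in Filter.atTop, c * t ^ δ ≤ A * t ^ γ + D := by
  intro h
  have hlim : Filter.Tendsto (fun t : ℝ => A * t ^ (-(δ - γ)) + D * t ^ (-δ)) Filter.atTop
      (nhds 0) := by
    simpa using ((tendsto_rpow_neg_atTop (sub_pos.2 hγδ)).const_mul A).add
      ((tendsto_rpow_neg_atTop hδ).const_mul D)
  refine hc.not_ge (ge_of_tendsto hlim ?_)
  filter_upwards [h, Filter.eventually_gt_atTop 0] with t ht ht0
  calc c = c * t ^ δ * t ^ (-δ) := by
        rw [mul_assoc, ← Real.rpow_add ht0, add_neg_cancel, Real.rpow_zero, mul_one]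
    _ ≤ (A * t ^ γ + D) * t ^ (-δ) := by gcongr
    _ = A * t ^ (-(δ - γ)) + D * t ^ (-δ) := by
        rw [add_mul, mul_assoc, ← Real.rpow_add ht0, neg_sub, sub_eq_add_neg]

namespace StratifiedGroup

variable {d : ℕ} {G : StratifiedGroup d} {N : (Fin d → ℝ) → ℝ}

theorem IsSmoothHomogeneousNorm.exists_gibbsMeasure_real_box_le (hN : G.IsSmoothHomogeneousNorm N)
    (hG : G.Noncommutative) {α p : ℝ} (hα : 0 < α) (hp : 0 < p) :
    ∃ c > 0, ∃ Λ : ℝ, ∀ᶠ t : ℝ in Filter.atTop, ∃ y,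
      0 < (gibbsMeasure N α p).real (G.box y (t ^ (1 - p / 2)) 1) ∧
      (gibbsMeasure N α p).real (G.box y (t ^ (1 - p / 2)) 2) ≤
        Λ * (gibbsMeasure N α p).real (G.box y (t ^ (1 - p / 2)) 1) ∧
      (gibbsMeasure N α p).real (G.box y (t ^ (1 - p / 2)) 2) ≤ Real.exp (-(c * t ^ p)) := by
  obtain ⟨M, hM, B, hosc⟩ := hN.exists_abs_rpow_sub_le_of_mem_box hG hp 2
  have hi := hN.integrable_exp hα hp
  have hi' := hN.integrable_exp (half_pos hα) hp
  have hZ := integral_exp_pos hi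
  have hαM : α * M / 4 < α * M / 2 := by linarith [mul_pos hα hM]
  refine ⟨α * M / 4, by positivity, Real.exp (2 * α * B) * 2 ^ d, ?_⟩
  filter_upwards [hosc, Filter.eventually_gt_atTop 0, (tendsto_rpow_atTop hp).eventually
    (eventually_mul_exp_le_exp ((∫ x, Real.exp (-α * N x ^ p))⁻¹ *
      (∫ x, Real.exp (-(α / 2) * N x ^ p)) * Real.exp (α * B / 2)) hαM)] with t ⟨y, hy⟩ ht0 hexp
  set r := t ^ (1 - p / 2)
  have hr : 0 < r := Real.rpow_pos_of_pos ht0 _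
  have hlow : ∀ z ∈ G.box y r 2, t ^ p * M - B ≤ N z ^ p := fun z hz => by
    linarith [(abs_le.1 (hy z hz)).1]
  have hupp : ∀ z ∈ G.box y r 1, N z ^ p ≤ t ^ p * M + B := fun z hz => by
    linarith [(abs_le.1 (hy z (G.box_subset_box y r one_le_two hz))).2]
  have hvol : volume.real (G.box y r 2) = 2 ^ d * volume.real (G.box y r 1) := by
    rw [G.volumeReal_box y hr zero_le_two, G.volumeReal_box y hr zero_le_one, mul_pow, mul_pow]
    ring
  have hpos : 0 < volume.real (G.box y r 1) := by
    rw [G.volumeReal_box y hr zero_le_one]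
    positivity
  have hfin : ∀ R : ℝ, 0 ≤ R → volume (G.box y r R) ≠ ⊤ := fun R hR =>
    (G.volume_box y hr hR).trans_ne ENNReal.ofReal_ne_top
  refine ⟨y, ?_, ?_, ?_⟩
  · exact lt_of_lt_of_le (by positivity)
      (le_gibbsMeasure_real hi hα.le (G.measurableSet_box y r 1) (hfin 1 zero_le_one) hupp)
  · exact gibbsMeasure_real_le_mul_gibbsMeasure_real hi hα.le (G.measurableSet_box y r 1)
      (G.measurableSet_box y r 2) (hfin 1 zero_le_one) (hfin 2 zero_le_two)
      (by positivity) hvol.le hupp hlow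
  · refine (gibbsMeasure_real_le_mul_exp hi hi' (half_le_self hα.le) (G.measurableSet_box y r 2)
      hlow).trans (le_trans (le_of_eq ?_) hexp)
    rw [_root_.mul_assoc _ (Real.exp (α * B / 2)), ← Real.exp_add]
    ring_nf

end StratifiedGroup

theorem theorem10_general {d : ℕ} {G : StratifiedGroup d} (hG : G.Noncommutative)
    {N : (Fin d → ℝ) → ℝ} (hN : G.IsSmoothHomogeneousNorm N) {α p : ℝ} (hα : 0 < α) (hp : 0 < p)
    {β q : ℝ} (hβ : 0 < β) (hq : 0 < q) (hpq : q * (p - 2) < 2 * p * β) :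
    ¬ G.LogSobolev (gibbsMeasure N α p) β q := by
  intro h
  have : IsProbabilityMeasure (gibbsMeasure N α p) :=
    isProbabilityMeasure_gibbsMeasure (hN.integrable_exp hα hp)
  obtain ⟨C, hC, D, hD, hbox⟩ := h.exists_rpow_mul_measureReal_box_le hβ.le hq
  obtain ⟨c, hc, Λ, hmass⟩ := hN.exists_gibbsMeasure_real_box_le hG hα hp
  refine not_eventually_mul_rpow_le (c := c ^ β) (A := C * Λ) (D := D * Λ)
    (γ := q * (p / 2 - 1)) (δ := p * β) (by positivity) (by positivity) (by linarith) ?_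
  filter_upwards [hmass, Filter.eventually_gt_atTop 0] with t ⟨y, hpos, hratio, hsmall⟩ ht0
  set r := t ^ (1 - p / 2) with hr
  set m := (gibbsMeasure N α p).real (G.box y r 1)
  have hrq : r⁻¹ ^ q = t ^ (q * (p / 2 - 1)) := by
    rw [hr, ← Real.rpow_neg ht0.le, ← Real.rpow_mul ht0.le]
    ring_nf
  refine le_of_mul_le_mul_right ?_ hpos
  calc c ^ β * t ^ (p * β) * m = (c * t ^ p) ^ β * m := by
        rw [Real.mul_rpow hc.le (by positivity), ← Real.rpow_mul ht0.le]
    _ ≤ (C * r⁻¹ ^ q + D) * (gibbsMeasure N α p).real (G.box y r 2) :=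
        hbox y r _ (by positivity) (by positivity) hpos hsmall
    _ ≤ (C * r⁻¹ ^ q + D) * (Λ * m) := by gcongr
    _ = (C * Λ * t ^ (q * (p / 2 - 1)) + D * Λ) * m := by
        rw [hrq]
        ring

end

theorem theorem10 {d : ℕ} (G : StratifiedGroup d) (hG : G.Noncommutative)
    (N : (Fin d → ℝ) → ℝ) (hN : G.IsSmoothHomogeneousNorm N)
    (α p : ℝ) (hα : 0 < α) (hp : 1 ≤ p)
    (β q : ℝ) (hβ : 0 < β) (hβ1 : β ≤ 1)
    -- `q < 2pβ/(p-1)`, read as no condition when `p = 1`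
    (hq : 1 < q) (hq' : q * (p - 1) < 2 * p * β) :
    ¬ G.LogSobolev (gibbsMeasure N α p) β q :=
  theorem10_general hG hN hα (by linarith) hβ (by linarith) (by linarith)
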